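/- Let $g\ge 0$ and $-1<\alpha_1<\beta_1<\alpha_2<\beta_2<\dots<\alpha_g<\beta_g<1$, let $$E=[-1,\alpha_1]\cup[\beta_1,\alpha_2]\cup\dots\cup[\beta_g,1],\qquad w(x)=\frac1\pi\sqrt{\frac{\prod_{j=1}^g(x-\alpha_j)}{(1-x^2)\prod_{j=1}^g(x-\beta_j)}}\quad(x\in E),$$ let $P_n$ be the monic orthogonal polynomials of $w$ on $E$, $h_n=\int_E P_n^2\,w\,dx$, let $Q_n(z)=\int_E\frac{P_n(z)-P_n(t)}{z-t}\,w(t)\,dt$ be the polynomials of the second kind, and let $a_n,b_n$ be the coefficients of the recurrence $xP_n=P_{n+1}+b_{n+1}P_n+a_nP_{n-1}$. Let $\mathfrak K\ge 1$ be an integer such that the recurrence coefficients have period $\mathfrak K$, that is, $b_{n+\mathfrak K}=b_n$ for $n\ge1$ and $a_{n+\mathfrak K}=a_n$ for $n\ge2$. Put $\Delta_{\mathfrak K}=\sqrt{2h_{\mathfrak K}}$. Then $g\le\mathfrak K-1$, and one can insert $\mathfrak K-1-g$ closed gaps (pairs of equal points $\alpha_j=\beta_j$ in the interior of $E$) into the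 list of gaps so that, after renumbering, $-1<\alpha_1\le\beta_1<\alpha_2\le\dots\le\beta_{\mathfrak K-1}<1$, the set $E$ is the union of the $\mathfrak K$ subintervals $E_1=[-1,\alpha_1],\,E_2=[\beta_1,\alpha_2],\dots,E_{\mathfrak K}=[\beta_{\mathfrak K-1},1]$, and $P_{\mathfrak K}/\Delta_{\mathfrak K}$ maps each $E_i$ bijectively onto $[-1,1]$ (if $g=\mathfrak K-1$, nothing is inserted). Moreover: 1. For every $n\ge0$, $P_{n\mathfrak K}=\Delta_{\mathfrak K}^n\,T_n(P_{\mathfrak K}/\Delta_{\mathfrak K})$, where $T_n$ is the monic Chebyshev polynomial of the first kind; all complex zeros of $P_{n\mathfrak K}$ are simple and lie in $E$; and each $E_i$ contains exactly $n$ of them, all in the interior of $E_i$. 2. For every $n\ge1$, $Q_{n\mathfrak K}$ vanishes at $\alpha_1,\dots,\alpha_{\mathfrak K-1}$; all its other complex zeros lie in the interiors of the $E_i$; the interior of each $E_i$ contains exactly $n-1$ of them; and these interlace with the $n$ zeros of $P_{n\mathfrak K}$ in $E_i$. -/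

import Mathlib

open Polynomial

noncomputable section

namespace GenCheb

/-- Left end points of the `g + 1` subintervals: `-1, β₁, …, β_g`. -/
def bandLeft {g : ℕ} (β : Fin g → ℝ) (i : Fin (g + 1)) : ℝ :=
  Fin.cons (α := fun _ => ℝ) (-1) β i

/-- Right end points of the `g + 1` subintervals: `α₁, …, α_g, 1`. -/
def bandRight {g : ℕ} (α : Fin g → ℝ) (i : Fin (g + 1)) : ℝ :=
  Fin.snoc (α := fun _ => ℝ) α 1 i

/-- The closed subintervals `[-1, α₁], [β₁, α₂], …, [β_g, 1]`. -/
def band {g : ℕ} (α β : Fin g → ℝ) (i : Fin (g + 1)) : Set ℝ :=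
  Set.Icc (bandLeft β i) (bandRight α i)

/-- `E = [-1, α₁] ∪ [β₁, α₂] ∪ ⋯ ∪ [β_g, 1]`. -/
def bandSet {g : ℕ} (α β : Fin g → ℝ) : Set ℝ :=
  ⋃ i, band α β i

/-- `-1 < α₁ ≤ β₁ < α₂ ≤ β₂ < ⋯ ≤ β_g < 1`: the subintervals are nondegenerate, the gaps
`(α_j, β_j)` may be closed. -/
def Ordered {g : ℕ} (α β : Fin g → ℝ) : Prop :=
  (∀ i, bandLeft β i < bandRight α i) ∧ ∀ j, α j ≤ β j

/-- `-1 < α₁ < β₁ < α₂ < ⋯ < β_g < 1`: as `Ordered`, with all gaps open. -/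
def StrictlyOrdered {g : ℕ} (α β : Fin g → ℝ) : Prop :=
  (∀ i, bandLeft β i < bandRight α i) ∧ ∀ j, α j < β j

/-- The weight `w(x) = (1/π) √(∏(x - α_j) / ((1 - x²) ∏(x - β_j)))`. -/
def weight {g : ℕ} (α β : Fin g → ℝ) (x : ℝ) : ℝ :=
  1 / Real.pi * Real.sqrt ((∏ j, (x - α j)) / ((1 - x ^ 2) * ∏ j, (x - β j)))

/-- `⟨p, q⟩ = ∫_E p(x) q(x) w(x) dx`. -/
def ip {g : ℕ} (α β : Fin g → ℝ) (p q : ℝ[X]) : ℝ :=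
  ∫ x in bandSet α β, p.eval x * q.eval x * weight α β x

/-- The monic orthogonal polynomials `P_n` of the weight `w` on `E`, by the Gram–Schmidt process
applied to `1, x, x², …`. -/
def P {g : ℕ} (α β : Fin g → ℝ) (n : ℕ) : ℝ[X] :=
  X ^ n - ∑ k : Fin n, C (ip α β (X ^ n) (P α β k) / ip α β (P α β k) (P α β k)) * P α β k
termination_by n
decreasing_by exact k.2

/-- `h_n = ∫_E P_n² w`. -/
def h {g : ℕ} (α β : Fin g → ℝ) (n : ℕ) : ℝ :=
  ip α β (P α β n) (P α β n)

/-- The polynomial of the second kind, as a function on `ℂ`: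
`Q_n(z) = ∫_E (P_n(z) - P_n(t)) / (z - t) w(t) dt`. -/
def Q {g : ℕ} (α β : Fin g → ℝ) (n : ℕ) (z : ℂ) : ℂ :=
  ∫ t in bandSet α β,
    (aeval z (P α β n) - (((P α β n).eval t : ℝ) : ℂ)) / (z - (t : ℂ)) * (weight α β t : ℂ)

/-- The coefficient `a_n` (`n ≥ 1`) of `x P_n = P_{n+1} + b_{n+1} P_n + a_n P_{n-1}`. -/
def recA {g : ℕ} (α β : Fin g → ℝ) (n : ℕ) : ℝ :=
  h α β n / h α β (n - 1)

/-- The coefficient `b_n` (`n ≥ 1`) of `x P_{n-1} = P_n + b_n P_{n-1} + a_{n-1} P_{n-2}`. -/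
def recB {g : ℕ} (α β : Fin g → ℝ) (n : ℕ) : ℝ :=
  ip α β (X * P α β (n - 1)) (P α β (n - 1)) / h α β (n - 1)

/-- The recurrence coefficients have period `K`: `b_{n+K} = b_n` for `n ≥ 1` and
`a_{n+K} = a_n` for `n ≥ 2`. -/
def HasPeriod {g : ℕ} (α β : Fin g → ℝ) (K : ℕ) : Prop :=
  (∀ n, 1 ≤ n → recB α β (n + K) = recB α β n) ∧
    ∀ n, 2 ≤ n → recA α β (n + K) = recA α β n

/-- `Δ_K = √(2 h_K)`. -/
def Δ {g : ℕ} (α β : Fin g → ℝ) (K : ℕ) : ℝ :=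
  Real.sqrt (2 * h α β K)

/-- The monic Chebyshev polynomial of the first kind of degree `n`. -/
def monicT (n : ℕ) : ℝ[X] :=
  C ((2 : ℝ) ^ (n - 1))⁻¹ * Chebyshev.T ℝ n

/-- The end points `α', β'` arise from `α, β` by inserting closed gaps `α'_k = β'_k`. -/
def InsertsClosedGaps {g m : ℕ} (α β : Fin g → ℝ) (α' β' : Fin m → ℝ) : Prop :=
  Ordered α' β' ∧ bandSet α' β' = bandSet α β ∧
    ∃ ι : Fin g → Fin m, StrictMono ι ∧ (∀ j, α' (ι j) = α j ∧ β' (ι j) = β j) ∧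
      ∀ k, k ∉ Set.range ι → α' k = β' k

/-- Between two points of either set lies a point of the other one. -/
def Interlace (A B : Set ℝ) : Prop :=
  (∀ x ∈ A, ∀ x' ∈ A, x < x' → ∃ y ∈ B, x < y ∧ y < x') ∧
    ∀ y ∈ B, ∀ y' ∈ B, y < y' → ∃ x ∈ A, y < x ∧ x < y'

end GenCheb

end

open GenCheb

/-!
For `x > 1` let `ψ_n(x) = ∫_E P_n(t) / (x - t) w(t) dt = P_n(x) ψ₀(x) - Q_n(x)`, the decaying
solution of the three-term recurrence. The weight is chosen such that `ψ₀²` is the rational function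
`∏ (x - α_j) / ((x² - 1) ∏ (x - β_j))`. By periodicity the shifted sequence `ψ_{n+K}` is also a
decaying solution, hence proportional to `ψ_n`. This is a quadratic equation for `ψ₀`; since `ψ₀` is
irrational, its coefficients vanish, which yields `Q_K = S ∏ (x - α_j)` with a polynomial `S` and
the Pell equation `P_K² - Δ² = (x² - 1) ∏ (x - α_j)(x - β_j) S²`.

Put `p = P_K / Δ`. Every zero of `p² - 1` other than `±1`, `α_j`, `β_j` is a double one, and the
zeros of `S` are critical points of `p`; they are the closed gaps. Counting critical points leaves
exactly one more in each open gap, so that `p` is injective on each band. The periodic recurrence is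
the Chebyshev recurrence in `p`: up to constants `P_{nK} = T_n(p)` and `Q_{nK} = Q_K U_{n-1}(p)`,
and the zeros of `T_n` and `U_{n-1}` in `(-1, 1)` are pulled back along `p`.
-/

noncomputable section

namespace GenCheb

section Bands

variable {g : ℕ} {α β : Fin g → ℝ}

@[simp] lemma bandLeft_zero : bandLeft β 0 = -1 := rfl

@[simp] lemma bandLeft_succ (j : Fin g) : bandLeft β j.succ = β j := rfl

@[simp] lemma bandRight_last : bandRight α (Fin.last g) = 1 := by simp [bandRight]

@[simp] lemma bandRight_castSucc (j : Fin g) : bandRight α j.castSucc = α j := by simp [bandRight]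

lemma StrictlyOrdered.ordered (ho : StrictlyOrdered α β) : Ordered α β :=
  ⟨ho.1, fun j => (ho.2 j).le⟩

lemma Ordered.left_lt (ho : Ordered α β) (j : Fin g) : bandLeft β j.castSucc < α j := by
  simpa using ho.1 j.castSucc

lemma Ordered.lt_right (ho : Ordered α β) (j : Fin g) : β j < bandRight α j.succ := by
  simpa using ho.1 j.succ

lemma Ordered.strictMono_left (ho : Ordered α β) : StrictMono (bandLeft β) :=
  Fin.strictMono_iff_lt_succ.2 fun j => (ho.left_lt j).trans_le (ho.2 j)

lemma Ordered.strictMono_right (ho : Ordered α β) : StrictMono (bandRight α) :=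
  Fin.strictMono_iff_lt_succ.2 fun j => by
    simpa using (ho.2 j).trans_lt (ho.lt_right j)

lemma Ordered.strictMono_β (ho : Ordered α β) : StrictMono β := fun i j hij => by
  simpa using ho.strictMono_left (Fin.succ_lt_succ_iff.2 hij)

lemma Ordered.neg_one_lt_α (ho : Ordered α β) (j : Fin g) : -1 < α j :=
  ((ho.strictMono_left.monotone (Fin.zero_le j.castSucc)).trans_lt (ho.left_lt j))

lemma Ordered.β_lt_one (ho : Ordered α β) (j : Fin g) : β j < 1 := by
  simpa using (ho.lt_right j).trans_le (ho.strictMono_right.monotone (Fin.le_last j.succ))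

lemma Ordered.α_lt_one (ho : Ordered α β) (j : Fin g) : α j < 1 :=
  (ho.2 j).trans_lt (ho.β_lt_one j)

lemma Ordered.neg_one_lt_β (ho : Ordered α β) (j : Fin g) : -1 < β j :=
  (ho.neg_one_lt_α j).trans_le (ho.2 j)

lemma Ordered.β_lt_α (ho : Ordered α β) {i j : Fin g} (hij : i < j) : β i < α j :=
  (ho.lt_right i).trans_le <| by
    simpa using ho.strictMono_right.monotone (show i.succ ≤ j.castSucc from hij)

lemma Ordered.le_or_ge_of_mem_band (ho : Ordered α β) {i : Fin (g + 1)} {x : ℝ}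
    (hx : x ∈ band α β i) (j : Fin g) : x ≤ α j ∨ β j ≤ x := by
  rcases le_or_gt i j.castSucc with h | h
  · left
    simpa using hx.2.trans (ho.strictMono_right.monotone h)
  · right
    have h' : j.succ ≤ i := h
    simpa using (ho.strictMono_left.monotone h').trans hx.1

lemma Ordered.lt_or_gt_of_mem_Ioo (ho : Ordered α β) {i : Fin (g + 1)} {x : ℝ}
    (hx : x ∈ Set.Ioo (bandLeft β i) (bandRight α i)) (j : Fin g) : x < α j ∨ β j < x := by
  rcases le_or_gt i j.castSucc with h | h
  · left
    simpa using hx.2.trans_le (ho.strictMono_right.monotone h)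
  · right
    have h' : j.succ ≤ i := h
    simpa using (ho.strictMono_left.monotone h').trans_lt hx.1

lemma Ordered.right_le_left (ho : Ordered α β) {i j : Fin (g + 1)} (hij : i < j) :
    bandRight α i ≤ bandLeft β j := by
  obtain ⟨m, rfl⟩ : ∃ m : Fin g, i = m.castSucc :=
    ⟨i.castPred (Fin.ne_last_of_lt hij), by simp⟩
  rw [bandRight_castSucc]
  refine (ho.2 m).trans ?_
  simpa using ho.strictMono_left.monotone (show m.succ ≤ j from hij)

lemma Ordered.bandSet_eq (ho : Ordered α β) :
    bandSet α β = {x | x ∈ Set.Icc (-1) 1 ∧ ∀ j, x ≤ α j ∨ β j ≤ x} := by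
  ext x
  simp only [bandSet, Set.mem_iUnion, Set.mem_ofPred_eq]
  constructor
  · rintro ⟨i, hi⟩
    refine ⟨⟨?_, ?_⟩, ho.le_or_ge_of_mem_band hi⟩
    · exact (ho.strictMono_left.monotone (Fin.zero_le i)).trans hi.1
    · simpa using hi.2.trans (ho.strictMono_right.monotone (Fin.le_last i))
  · rintro ⟨hx, hj⟩
    let s : Finset (Fin (g + 1)) := Finset.univ.filter fun i => bandLeft β i ≤ x
    have hs : s.Nonempty := ⟨0, by simpa [s] using hx.1⟩
    have hi : bandLeft β (s.max' hs) ≤ x := by simpa [s] using s.max'_mem hs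
    refine ⟨s.max' hs, hi, ?_⟩
    rcases Fin.eq_castSucc_or_eq_last (s.max' hs) with ⟨j, hj'⟩ | h
    · rw [hj']
      rcases hj j with h | h
      · simpa using h
      · exfalso
        have h2 : j.succ ∈ s := by simpa [s] using h
        have h3 := s.le_max' _ h2
        rw [hj'] at h3
        exact absurd h3 (not_le.2 (Fin.castSucc_lt_succ))
    · rw [h]; simpa using hx.2

lemma Ordered.bandSet_subset (ho : Ordered α β) : bandSet α β ⊆ Set.Icc (-1) 1 := by
  rw [ho.bandSet_eq]; exact fun x hx => hx.1

lemma isCompact_bandSet : IsCompact (bandSet α β) := isCompact_iUnion fun _ => isCompact_Icc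

lemma measurableSet_bandSet : MeasurableSet (bandSet α β) := isCompact_bandSet.measurableSet

end Bands

section Integrability

open MeasureTheory

lemma intervalIntegrable_inv_sqrt_abs (c : ℝ) :
    IntervalIntegrable (fun x : ℝ => (√|x|)⁻¹) volume 0 c := by
  have of_nonneg {c : ℝ} (hc : 0 ≤ c) :
      IntervalIntegrable (fun x : ℝ => (√|x|)⁻¹) volume 0 c := by
    refine (intervalIntegral.intervalIntegrable_rpow' (r := -(1/2)) (by norm_num)).congr ?_
    intro x hx
    rw [Set.uIoc_of_le hc] at hx
    simp only
    rw [abs_of_pos hx.1, Real.rpow_neg hx.1.le, Real.sqrt_eq_rpow]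
  rcases le_total 0 c with hc | hc
  · exact of_nonneg hc
  · have := (of_nonneg (neg_nonneg.2 hc)).comp_mul_left (c := -1)
    simpa using this

lemma intervalIntegrable_inv_sqrt_abs_sub (b c d : ℝ) :
    IntervalIntegrable (fun x : ℝ => (√|x - b|)⁻¹) volume c d := by
  have h := (intervalIntegrable_inv_sqrt_abs (c - b)).symm.trans
    (intervalIntegrable_inv_sqrt_abs (d - b))
  simpa using h.comp_sub_right b

lemma inv_sqrt_mul_inv_sqrt_le {b c : ℝ} (hbc : b ≠ c) (x : ℝ) :
    (√|x - b|)⁻¹ * (√|x - c|)⁻¹ ≤ (√|b - c|)⁻¹ * ((√|x - b|)⁻¹ + (√|x - c|)⁻¹) := by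
  have hd : 0 < √|b - c| := Real.sqrt_pos.2 (abs_pos.2 (sub_ne_zero.2 hbc))
  rcases (Real.sqrt_nonneg |x - b|).eq_or_lt with hu | hu
  · rw [← hu, inv_zero, zero_mul]
    positivity
  rcases (Real.sqrt_nonneg |x - c|).eq_or_lt with hv | hv
  · rw [← hv, inv_zero, mul_zero]
    positivity
  have hsqrt_le : √|b - c| ≤ √|x - b| + √|x - c| := by
    refine (Real.sqrt_le_left (by positivity)).2 ?_
    have htriangle : |b - c| ≤ |x - b| + |x - c| := by
      rw [abs_sub_comm x b]; exact abs_sub_le b x c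
    have hb_sq := Real.sq_sqrt (abs_nonneg (x - b))
    have hc_sq := Real.sq_sqrt (abs_nonneg (x - c))
    nlinarith [mul_pos hu hv]
  field_simp
  linarith

lemma prod_inv_sqrt_le (s : Finset ℝ) (hs : s.Nonempty) :
    ∃ C, 0 ≤ C ∧ ∀ x : ℝ, ∏ b ∈ s, (√|x - b|)⁻¹ ≤ C * ∑ b ∈ s, (√|x - b|)⁻¹ := by
  induction hs using Finset.Nonempty.cons_induction with
  | singleton a => exact ⟨1, zero_le_one, fun x => by simp⟩
  | cons a s ha _ ih =>
    obtain ⟨C, hC, h⟩ := ih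
    have : 0 ≤ ∑ b ∈ s, (√|a - b|)⁻¹ := Finset.sum_nonneg fun _ _ => by positivity
    refine ⟨C * (∑ b ∈ s, (√|a - b|)⁻¹), by positivity, fun x => ?_⟩
    rw [Finset.prod_cons, Finset.sum_cons]
    calc (√|x - a|)⁻¹ * ∏ b ∈ s, (√|x - b|)⁻¹
        ≤ (√|x - a|)⁻¹ * (C * ∑ b ∈ s, (√|x - b|)⁻¹) := by gcongr; exact h x
      _ = C * ∑ b ∈ s, (√|x - a|)⁻¹ * (√|x - b|)⁻¹ := by
          rw [Finset.mul_sum, Finset.mul_sum, Finset.mul_sum]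
          exact Finset.sum_congr rfl fun _ _ => by ring
      _ ≤ C * ∑ b ∈ s, (√|a - b|)⁻¹ * ((√|x - a|)⁻¹ + ∑ b ∈ s, (√|x - b|)⁻¹) := by
          refine mul_le_mul_of_nonneg_left (Finset.sum_le_sum fun b hb => ?_) hC
          refine (inv_sqrt_mul_inv_sqrt_le (ne_of_mem_of_not_mem hb ha).symm x).trans ?_
          gcongr
          exact Finset.single_le_sum (f := fun b => (√|x - b|)⁻¹)
            (fun _ _ => by positivity) hb
      _ = _ := by rw [← Finset.sum_mul, mul_assoc]

lemma measurable_prod_inv_sqrt (s : Finset ℝ) :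
    Measurable fun x : ℝ => ∏ b ∈ s, (√|x - b|)⁻¹ :=
  Finset.measurable_fun_prod _ fun b _ => by fun_prop

lemma intervalIntegrable_prod_inv_sqrt (s : Finset ℝ) (c d : ℝ) :
    IntervalIntegrable (fun x : ℝ => ∏ b ∈ s, (√|x - b|)⁻¹) volume c d := by
  rcases s.eq_empty_or_nonempty with rfl | hs
  · simp
  obtain ⟨C, -, h⟩ := prod_inv_sqrt_le s hs
  have hmajorant : IntervalIntegrable (fun x : ℝ => C * ∑ b ∈ s, (√|x - b|)⁻¹) volume c d := by
    refine IntervalIntegrable.const_mul ?_ C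
    have := IntervalIntegrable.sum (μ := volume) (a := c) (b := d) s
      (f := fun b x => (√|x - b|)⁻¹) fun b _ => intervalIntegrable_inv_sqrt_abs_sub b c d
    simpa [Finset.sum_fn] using this
  refine hmajorant.mono_fun (measurable_prod_inv_sqrt s).aestronglyMeasurable ?_
  refine Filter.Eventually.of_forall fun x => ?_
  beta_reduce
  rw [Real.norm_of_nonneg (Finset.prod_nonneg fun _ _ => by positivity)]
  exact (h x).trans (le_abs_self _)

end Integrability

section Weight

open MeasureTheory

variable {g : ℕ} {α β : Fin g → ℝ}

/-- The points at which the weight is singular. -/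
def singSet (β : Fin g → ℝ) : Finset ℝ :=
  insert 1 (insert (-1) (Finset.univ.image β))

lemma notMem_singSet {x : ℝ} : x ∉ singSet β ↔ x ≠ 1 ∧ x ≠ -1 ∧ ∀ j, x ≠ β j := by
  simp [singSet, eq_comm]

lemma Ordered.abs_le_one_of_mem_singSet (ho : Ordered α β) {b : ℝ} (hb : b ∈ singSet β) :
    |b| ≤ 1 := by
  simp only [singSet, Finset.mem_insert, Finset.mem_image, Finset.mem_univ, true_and] at hb
  rcases hb with rfl | rfl | ⟨j, rfl⟩
  · simp
  · simp
  · exact abs_le.2 ⟨(ho.neg_one_lt_β j).le, (ho.β_lt_one j).le⟩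

lemma Ordered.prod_singSet (ho : Ordered α β) {M : Type*} [CommMonoid M] (f : ℝ → M) :
    ∏ b ∈ singSet β, f b = f 1 * (f (-1) * ∏ j, f (β j)) := by
  classical
  rw [singSet, Finset.prod_insert, Finset.prod_insert, Finset.prod_image]
  · exact fun i _ j _ h => ho.strictMono_β.injective h
  · simp only [Finset.mem_image, Finset.mem_univ, true_and, not_exists]
    exact fun j h => absurd h (ho.neg_one_lt_β j).ne'
  · simp only [Finset.mem_insert, Finset.mem_image, Finset.mem_univ, true_and, not_or, not_exists]
    exact ⟨by norm_num, fun j h => absurd h (ho.β_lt_one j).ne⟩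

lemma weight_nonneg (x : ℝ) : 0 ≤ weight α β x := by unfold weight; positivity

lemma measurable_weight : Measurable (weight α β) := by
  unfold weight
  refine Measurable.const_mul ?_ _
  refine Measurable.sqrt ?_
  refine Measurable.div ?_ (Measurable.mul (by fun_prop) ?_) <;>
  exact Finset.measurable_fun_prod _ fun b _ => by fun_prop

lemma sqrt_abs_prod {ι : Type*} (s : Finset ι) (f : ι → ℝ) :
    √|∏ i ∈ s, f i| = ∏ i ∈ s, √|f i| := by
  rw [Finset.abs_prod, Real.sqrt_prod _ fun _ _ => abs_nonneg _]

lemma Ordered.weight_le (ho : Ordered α β) (x : ℝ) :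
    weight α β x ≤ 1 / Real.pi * √|∏ j, (x - α j)| * ∏ b ∈ singSet β, (√|x - b|)⁻¹ := by
  unfold weight
  rw [mul_assoc]
  gcongr
  refine (Real.sqrt_le_sqrt (le_abs_self _)).trans_eq ?_
  rw [ho.prod_singSet, abs_div, Real.sqrt_div (abs_nonneg _), abs_mul, Real.sqrt_mul (abs_nonneg _),
    sqrt_abs_prod _ fun j => x - β j, Finset.prod_inv_distrib,
    show 1 - x ^ 2 = -((x - 1) * (x - -1)) by ring, abs_neg, abs_mul, Real.sqrt_mul (abs_nonneg _)]
  field_simp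

lemma Ordered.integrableOn_weight (ho : Ordered α β) :
    IntegrableOn (weight α β) (bandSet α β) := by
  have hmajorant : IntegrableOn (fun x => 1 / Real.pi * √|∏ j, (x - α j)| *
      ∏ b ∈ singSet β, (√|x - b|)⁻¹) (Set.Icc (-1) 1) := by
    refine IntegrableOn.continuousOn_mul ?_ ?_ isCompact_Icc
    · refine Continuous.continuousOn ?_
      have : Continuous fun x : ℝ => ∏ j, (x - α j) :=
        continuous_finsetProd _ fun _ _ => by fun_prop
      fun_prop
    · have := intervalIntegrable_prod_inv_sqrt (singSet β) (-1) 1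
      rwa [intervalIntegrable_iff_integrableOn_Icc_of_le (by norm_num)] at this
  refine Integrable.mono' (hmajorant.mono_set ho.bandSet_subset)
    measurable_weight.aestronglyMeasurable ?_
  refine Filter.Eventually.of_forall fun x => ?_
  rw [Real.norm_of_nonneg (weight_nonneg x)]
  exact ho.weight_le x

lemma Ordered.integrableOn_mul_weight (ho : Ordered α β) {f : ℝ → ℝ}
    (hf : ContinuousOn f (bandSet α β)) :
    IntegrableOn (fun x => f x * weight α β x) (bandSet α β) :=
  ho.integrableOn_weight.continuousOn_mul hf isCompact_bandSet

lemma Ordered.div_pos_of_le_or_ge (ho : Ordered α β) {x : ℝ} (hα : ∀ j, x ≠ α j)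
    (hβ : ∀ j, x ≠ β j) {j : Fin g} (hj : x ≤ α j ∨ β j ≤ x) : 0 < (x - α j) / (x - β j) := by
  have h := ho.2 j
  rcases hj with hx | hx
  · have := hx.lt_of_ne (hα j)
    exact div_pos_of_neg_of_neg (by linarith) (by linarith)
  · have := hx.lt_of_ne' (hβ j)
    exact div_pos (by linarith) (by linarith)

lemma Ordered.weight_pos (ho : Ordered α β) {x : ℝ} (hx : x ∈ bandSet α β)
    (hα : ∀ j, x ≠ α j) (hs : x ∉ singSet β) : 0 < weight α β x := by
  obtain ⟨hne_one, hne_neg_one, hβ⟩ := notMem_singSet.1 hs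
  obtain ⟨hx1, hx2⟩ := ho.bandSet_eq ▸ hx
  refine mul_pos (by positivity) (Real.sqrt_pos.2 ?_)
  rw [mul_comm, ← div_div, ← Finset.prod_div_distrib]
  refine div_pos (Finset.prod_pos fun j _ => ho.div_pos_of_le_or_ge hα hβ (hx2 j)) ?_
  nlinarith [hx1.2.lt_of_ne hne_one, hx1.1.lt_of_ne' hne_neg_one]

lemma Ordered.volume_bandSet_pos (ho : Ordered α β) : 0 < volume (bandSet α β) :=
  (show 0 < volume (band α β 0) by
    rw [band, Real.volume_Icc, ENNReal.ofReal_pos]; exact sub_pos.2 (ho.1 0)).trans_le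
    (measure_mono (Set.subset_iUnion _ 0))

lemma ae_ne_endpoints : ∀ᵐ x : ℝ, (∀ j, x ≠ α j) ∧ x ∉ singSet β := by
  have hfin : (Set.range α ∪ singSet β : Set ℝ).Finite :=
    (Set.finite_range α).union (singSet β).finite_toSet
  filter_upwards [compl_mem_ae_iff.2 (hfin.measure_zero volume)] with x hx
  simp only [Set.mem_compl_iff, Set.mem_union, Set.mem_range, not_or, not_exists,
    Finset.mem_coe] at hx
  exact ⟨fun j h => hx.1 j h.symm, hx.2⟩

lemma Ordered.ae_weight_pos (ho : Ordered α β) :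
    ∀ᵐ x ∂volume.restrict (bandSet α β), 0 < weight α β x := by
  rw [ae_restrict_iff' measurableSet_bandSet]
  filter_upwards [ae_ne_endpoints (α := α) (β := β)] with x ⟨hα, hs⟩ hx using ho.weight_pos hx hα hs

end Weight

section Recurrence

variable {R S : Type*} [CommRing R] [CommRing S] {a b : ℕ → R} {x : R} {u v : ℕ → R}

/-- `u` satisfies `x uₙ = uₙ₊₁ + bₙ₊₁ uₙ + aₙ uₙ₋₁` for `n ≥ 1`, with the indexing of `recA` and
`recB`: only the values `a₁, a₂, …` and `b₂, b₃, …` enter. -/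
def IsThreeTerm (a b : ℕ → R) (x : R) (u : ℕ → R) : Prop :=
  ∀ n, u (n + 2) = (x - b (n + 2)) * u (n + 1) - a (n + 1) * u n

lemma IsThreeTerm.add (hu : IsThreeTerm a b x u) (hv : IsThreeTerm a b x v) :
    IsThreeTerm a b x fun n => u n + v n := fun n => by
  linear_combination hu n + hv n

lemma IsThreeTerm.sub (hu : IsThreeTerm a b x u) (hv : IsThreeTerm a b x v) :
    IsThreeTerm a b x fun n => u n - v n := fun n => by
  linear_combination hu n - hv n

lemma IsThreeTerm.const_mul (c : R) (hu : IsThreeTerm a b x u) :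
    IsThreeTerm a b x fun n => c * u n := fun n => by
  linear_combination c * hu n

lemma IsThreeTerm.map (f : R →+* S) (hu : IsThreeTerm a b x u) :
    IsThreeTerm (fun n => f (a n)) (fun n => f (b n)) (f x) fun n => f (u n) := fun n => by
  simpa only [map_sub, map_mul] using congrArg f (hu n)

lemma IsThreeTerm.ext (hu : IsThreeTerm a b x u) (hv : IsThreeTerm a b x v) (h0 : u 0 = v 0)
    (h1 : u 1 = v 1) : ∀ n, u n = v n
  | 0 => h0
  | 1 => h1
  | n + 2 => by rw [hu, hv, hu.ext hv h0 h1 n, hu.ext hv h0 h1 (n + 1)]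

lemma IsThreeTerm.casoratian_succ (hu : IsThreeTerm a b x u) (hv : IsThreeTerm a b x v) (n : ℕ) :
    u (n + 1) * v (n + 2) - u (n + 2) * v (n + 1) =
      a (n + 1) * (u n * v (n + 1) - u (n + 1) * v n) := by
  linear_combination u (n + 1) * hv n - v (n + 1) * hu n

lemma IsThreeTerm.succ (hu : IsThreeTerm a b x u) :
    IsThreeTerm (fun n => a (n + 1)) (fun n => b (n + 1)) x fun n => u (n + 1) :=
  fun n => hu (n + 1)

lemma IsThreeTerm.add_period {K : ℕ} (hb : ∀ n, 1 ≤ n → b (n + K) = b n)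
    (ha : ∀ n, 2 ≤ n → a (n + K) = a n) (hu : IsThreeTerm a b x u) :
    IsThreeTerm (fun n => a (n + 1)) (fun n => b (n + 1)) x fun n => u (n + 1 + K) := fun n => by
  have h := hu (n + 1 + K)
  rwa [show n + 1 + K + 2 = n + 2 + 1 + K by ring, show n + 1 + K + 1 = n + 1 + 1 + K by ring,
    hb _ (by omega), ha _ (by omega)] at h

/-- The rule `a 1 = 2 * a (K + 1)` compensates the missing factor in `u K = v 0`. -/
lemma IsThreeTerm.two_mul_add_period {K : ℕ} (hu : IsThreeTerm a b x u)
    (hv : IsThreeTerm a b x v) (hb : ∀ n, 1 ≤ n → b (n + K) = b n)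
    (ha : ∀ n, 2 ≤ n → a (n + K) = a n) (ha_one : a 1 = 2 * a (K + 1))
    (h0 : u K = v 0) (h1 : 2 * u (K + 1) = v 1) (n : ℕ) :
    2 * u (n + 1 + K) = v (n + 1) := by
  refine ((hu.add_period hb ha).const_mul 2).ext hv.succ ?_ ?_ n
  · rw [zero_add, add_comm 1 K, h1]
  · have hb_two := hb 2 one_le_two
    rw [add_comm] at hb_two
    have hv_two := hv 0
    simp only [zero_add, one_add_one_eq_two] at hv_two ⊢
    rw [add_comm 2 K, hu K, hv_two, hb_two]
    linear_combination (x - b 2) * h1 + v 0 * ha_one - 2 * a (K + 1) * h0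

end Recurrence

section SimpleZeros

lemma aeval_ofReal_eq_zero (f : ℝ[X]) (x : ℝ) : aeval (x : ℂ) f = 0 ↔ f.eval x = 0 := by
  rw [← Complex.coe_algebraMap, aeval_algebraMap_apply, map_eq_zero, coe_aeval_eq_eval]

/-- All complex zeros of the real polynomial `f` are real and simple, and they lie in `s`. -/
structure HasSimpleZerosIn (f : ℝ[X]) (s : Set ℝ) : Prop where
  ne_zero : f ≠ 0
  splits : f.Splits
  nodup_roots : f.roots.Nodup
  mem {x : ℝ} : f.eval x = 0 → x ∈ s

variable {f : ℝ[X]} {s : Set ℝ}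

lemma HasSimpleZerosIn.of_card (hf : f ≠ 0) {Z : Finset ℝ} (hZ : ∀ x ∈ Z, x ∈ s ∧ f.eval x = 0)
    (hcard : f.natDegree ≤ Z.card) : HasSimpleZerosIn f s := by
  have hle : Z.val ≤ f.roots := (Multiset.le_iff_subset Z.nodup).2 fun x hx =>
    (mem_roots hf).2 (hZ x hx).2
  have hroots : f.roots = Z.val :=
    (Multiset.eq_of_le_of_card_le hle ((card_roots' f).trans hcard)).symm
  refine ⟨hf, splits_iff_card_roots.2 ((card_roots' f).antisymm ?_), hroots ▸ Z.nodup, ?_⟩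
  · rw [hroots]; exact hcard
  · intro x hx
    have : x ∈ Z.val := hroots ▸ (mem_roots hf).2 hx
    exact (hZ x this).1

lemma HasSimpleZerosIn.mono {t : Set ℝ} (hf : HasSimpleZerosIn f s) (hst : s ⊆ t) :
    HasSimpleZerosIn f t :=
  ⟨hf.ne_zero, hf.splits, hf.nodup_roots, fun hx => hst (hf.mem hx)⟩

lemma HasSimpleZerosIn.exists_of_aeval (hf : HasSimpleZerosIn f s) {z : ℂ} (hz : aeval z f = 0) :
    ∃ x ∈ s, f.eval x = 0 ∧ z = x := by
  have hmem : z ∈ (f.map (algebraMap ℝ ℂ)).roots := by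
    rw [mem_roots (map_ne_zero hf.ne_zero), IsRoot, eval_map_algebraMap]; exact hz
  rw [hf.splits.roots_map, Multiset.mem_map] at hmem
  obtain ⟨x, hx, rfl⟩ := hmem
  have hx0 : f.eval x = 0 := (mem_roots hf.ne_zero).1 hx
  exact ⟨x, hf.mem hx0, hx0, rfl⟩

lemma HasSimpleZerosIn.const_mul (hf : HasSimpleZerosIn f s) {c : ℝ} (hc : c ≠ 0) :
    HasSimpleZerosIn (C c * f) s where
  ne_zero := mul_ne_zero (C_ne_zero.2 hc) hf.ne_zero
  splits := (Splits.C c).mul hf.splits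
  nodup_roots := by rw [roots_C_mul _ hc]; exact hf.nodup_roots
  mem hx := hf.mem (by simpa [hc] using hx)

lemma HasSimpleZerosIn.card_roots_toFinset (hf : HasSimpleZerosIn f s) :
    f.roots.toFinset.card = f.natDegree := by
  rw [Multiset.toFinset_card_of_nodup hf.nodup_roots, hf.splits.natDegree_eq_card_roots]

lemma exists_derivative_eq_zero (f : ℝ[X]) {a b : ℝ} (hab : a < b) (h : f.eval a = f.eval b) :
    ∃ c ∈ Set.Ioo a b, f.derivative.eval c = 0 := by
  obtain ⟨c, hc, h0⟩ := exists_deriv_eq_zero hab f.continuous.continuousOn h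
  exact ⟨c, hc, by rwa [f.deriv] at h0⟩

lemma HasSimpleZerosIn.exists_critical_points {n : ℕ} (hf : HasSimpleZerosIn f s)
    (hdeg : f.natDegree = n + 1) :
    ∃ (x : Fin (n + 1) → ℝ) (y : Fin n → ℝ), StrictMono y ∧
      (∀ i, x i.castSucc < y i ∧ y i < x i.succ) ∧ (∀ t, f.eval t = 0 ↔ t ∈ Set.range x) ∧
      HasSimpleZerosIn f.derivative (Set.range y) ∧ ∀ i, f.derivative.eval (y i) = 0 := by
  have hcard : f.roots.toFinset.card = n + 1 := hf.card_roots_toFinset.trans hdeg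
  have hx0 : ∀ t, f.eval t = 0 ↔ t ∈ Set.range (f.roots.toFinset.orderEmbOfFin hcard) := fun t => by
    simp [hf.ne_zero]
  set x := f.roots.toFinset.orderEmbOfFin hcard
  have hrolle : ∀ i : Fin n, ∃ y ∈ Set.Ioo (x i.castSucc) (x i.succ), f.derivative.eval y = 0 :=
    fun i => exists_derivative_eq_zero f (x.strictMono i.castSucc_lt_succ)
      (((hx0 _).2 ⟨_, rfl⟩).trans ((hx0 _).2 ⟨_, rfl⟩).symm)
  choose y hy hy0 using hrolle
  have hmono : StrictMono y := fun i j hij => (hy i).2.trans_le <|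
    (x.strictMono.monotone (show i.succ ≤ j.castSucc from hij)).trans (hy j).1.le
  refine ⟨x, y, hmono, hy, hx0,
    HasSimpleZerosIn.of_card (Z := Finset.univ.image y) ?_ (by simp [hy0]) ?_, hy0⟩
  · intro h
    have := derivative_eq_zero.1 h
    omega
  · rw [Finset.card_image_of_injective _ hmono.injective, Finset.card_univ, Fintype.card_fin]
    exact (natDegree_derivative_le f).trans (by omega)

lemma HasSimpleZerosIn.derivative [hs : s.OrdConnected] (hf : HasSimpleZerosIn f s)
    (hdeg : f.natDegree ≠ 0) : HasSimpleZerosIn f.derivative s := by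
  obtain ⟨n, hn⟩ := Nat.exists_eq_succ_of_ne_zero hdeg
  obtain ⟨x, y, -, hxy, hx0, hf', -⟩ := hf.exists_critical_points hn
  refine hf'.mono ?_
  rintro _ ⟨i, rfl⟩
  exact hs.out (hf.mem ((hx0 _).2 ⟨_, rfl⟩)) (hf.mem ((hx0 _).2 ⟨_, rfl⟩))
    ⟨(hxy i).1.le, (hxy i).2.le⟩

lemma HasSimpleZerosIn.interlace_derivative (hf : HasSimpleZerosIn f s) (hdeg : f.natDegree ≠ 0) :
    Interlace {x | f.eval x = 0} {x | f.derivative.eval x = 0} := by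
  obtain ⟨n, hn⟩ := Nat.exists_eq_succ_of_ne_zero hdeg
  obtain ⟨x, y, hy, hxy, hx0, hf', -⟩ := hf.exists_critical_points hn
  constructor
  · intro t ht t' ht' htt'
    obtain ⟨c, hc, hc0⟩ :=
      exists_derivative_eq_zero f htt' (ht.trans (Eq.symm (ht' : f.eval t' = 0)))
    exact ⟨c, hc0, hc⟩
  · intro t ht t' ht' htt'
    obtain ⟨i, rfl⟩ := hf'.mem ht
    obtain ⟨j, rfl⟩ := hf'.mem ht'
    have hij : i < j := hy.lt_iff_lt.1 htt'
    have hsucc : x i.succ < y j := by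
      have hj : (⟨i + 1, by omega⟩ : Fin n) ≤ j := hij
      exact (hxy ⟨i + 1, by omega⟩).1.trans_le (hy.monotone hj)
    exact ⟨x i.succ, (hx0 _).2 ⟨_, rfl⟩, (hxy i).2, hsucc⟩

end SimpleZeros

section Orthogonal

lemma linearMap_C_mul {R : Type*} [CommRing R] (L : R[X] →ₗ[R] R) (c : R) (q : R[X]) :
    L (C c * q) = c * L q := by
  rw [← smul_eq_C_mul, map_smul, smul_eq_mul]

/-- `p 0, p 1, …` are monic polynomials of degrees `0, 1, …` that are orthogonal with respect to
the moment functional `L`. -/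
structure IsMonicOrthogonal {R : Type*} [CommRing R] (L : R[X] →ₗ[R] R) (p : ℕ → R[X]) : Prop where
  monic (n : ℕ) : (p n).Monic
  natDegree_eq (n : ℕ) : (p n).natDegree = n
  orthogonal {n k : ℕ} : k < n → L (p n * p k) = 0

namespace IsMonicOrthogonal

section CommRing

variable {R : Type*} [CommRing R] {L : R[X] →ₗ[R] R} {p : ℕ → R[X]}

lemma coeff_self (hp : IsMonicOrthogonal L p) (n : ℕ) : (p n).coeff n = 1 := by
  simpa only [hp.natDegree_eq] using (hp.monic n).coeff_natDegree

lemma coeff_of_lt (hp : IsMonicOrthogonal L p) {n m : ℕ} (h : n < m) : (p n).coeff m = 0 :=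
  coeff_eq_zero_of_natDegree_lt (by rwa [hp.natDegree_eq])

lemma degree_sub_C_mul_lt (hp : IsMonicOrthogonal L p) {n : ℕ} {q : R[X]}
    (hq : q.degree < (n + 1 : ℕ)) : (q - C (q.coeff n) * p n).degree < n := by
  rw [degree_lt_iff_coeff_zero] at hq ⊢
  intro m hm
  rcases hm.eq_or_lt with rfl | hm
  · simp [hp.coeff_self]
  · simp [hp.coeff_of_lt hm, hq m hm]

lemma map_mul_eq_zero (hp : IsMonicOrthogonal L p) {f : R[X]} {m : ℕ}
    (hf : ∀ k < m, L (f * p k) = 0) {q : R[X]} (hq : q.degree < m) : L (f * q) = 0 := by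
  induction m generalizing q with
  | zero =>
    have : q = 0 := by rw [← degree_eq_bot]; simpa using hq
    simp [this]
  | succ m ih =>
    have h := ih (fun k hk => hf k (hk.trans m.lt_succ_self)) (hp.degree_sub_C_mul_lt hq)
    rwa [mul_sub, map_sub, mul_left_comm, linearMap_C_mul, hf m m.lt_succ_self, mul_zero,
      sub_zero] at h

lemma map_mul_of_natDegree_le (hp : IsMonicOrthogonal L p) {n : ℕ} {q : R[X]}
    (hq : q.natDegree ≤ n) : L (p n * q) = q.coeff n * L (p n * p n) := by
  have h := hp.map_mul_eq_zero (fun _ => hp.orthogonal)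
    (hp.degree_sub_C_mul_lt (degree_lt_iff_coeff_zero _ _ |>.2 fun m hm =>
      coeff_eq_zero_of_natDegree_lt (hq.trans_lt hm)))
  rwa [mul_sub, map_sub, mul_left_comm, linearMap_C_mul, sub_eq_zero] at h

lemma map_mul_of_ne (hp : IsMonicOrthogonal L p) {n k : ℕ} (h : n ≠ k) : L (p n * p k) = 0 := by
  rcases h.lt_or_gt with h | h
  · rw [mul_comm]; exact hp.orthogonal h
  · exact hp.orthogonal h

lemma eq_zero_of_map_mul (hp : IsMonicOrthogonal L p) (hL : ∀ q ≠ 0, L (q * q) ≠ 0) {D : R[X]}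
    {n : ℕ} (hD : D.degree < n) (horth : ∀ k < n, L (D * p k) = 0) : D = 0 :=
  by_contra fun h => hL D h (hp.map_mul_eq_zero horth hD)

end CommRing

lemma X_mul {𝕜 : Type*} [Field 𝕜] {L : 𝕜[X] →ₗ[𝕜] 𝕜} {p : ℕ → 𝕜[X]}
    (hp : IsMonicOrthogonal L p) (hL : ∀ q ≠ 0, L (q * q) ≠ 0) (n : ℕ) :
    X * p (n + 1) = p (n + 2) +
      C (L (X * p (n + 1) * p (n + 1)) / L (p (n + 1) * p (n + 1))) * p (n + 1) +
      C (L (p (n + 1) * p (n + 1)) / L (p n * p n)) * p n := by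
  have hnorm : ∀ m, L (p m * p m) ≠ 0 := fun m => hL _ (hp.monic m).ne_zero
  refine sub_eq_zero.1 (hp.eq_zero_of_map_mul hL (n := n + 2) ?_ fun k hk => ?_)
  · rw [degree_lt_iff_coeff_zero]
    intro m hm
    obtain ⟨m, rfl⟩ := Nat.exists_eq_succ_of_ne_zero (show m ≠ 0 by omega)
    rcases hm.eq_or_lt with h | h
    · obtain rfl : n + 1 = m := by omega
      simp [hp.coeff_self, hp.coeff_of_lt]
    · simp [hp.coeff_of_lt (show n + 1 < m by omega), hp.coeff_of_lt (show n + 2 < m + 1 by omega),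
        hp.coeff_of_lt (show n + 1 < m + 1 by omega), hp.coeff_of_lt (show n < m + 1 by omega)]
  · have hX : k ≤ n → L (X * p (n + 1) * p k) = (p k).coeff n * L (p (n + 1) * p (n + 1)) :=
      fun hk => by
        rw [mul_right_comm, mul_comm, hp.map_mul_of_natDegree_le, coeff_X_mul]
        exact (natDegree_mul_le_of_le natDegree_X_le (hp.natDegree_eq k).le).trans (by omega)
    rw [sub_mul, add_mul, add_mul, map_sub, map_add, map_add, mul_assoc (C _), mul_assoc (C _),
      linearMap_C_mul, linearMap_C_mul, hp.map_mul_of_ne (show n + 2 ≠ k by omega)]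
    rcases lt_trichotomy k n with h | rfl | h
    · rw [hX h.le, hp.coeff_of_lt h, hp.orthogonal h, hp.orthogonal (show k < n + 1 by omega)]
      simp
    · rw [hX le_rfl, hp.coeff_self, hp.orthogonal k.lt_succ_self, div_mul_cancel₀ _ (hnorm k)]
      simp
    · obtain rfl : k = n + 1 := by omega
      rw [hp.map_mul_of_ne (show n ≠ n + 1 by omega), div_mul_cancel₀ _ (hnorm _)]
      simp

/-- With `M 1 = 0` and `c = 1` this describes the polynomials of the second kind, with `c = -1` the
functions of the second kind. -/
lemma map_eq {R A : Type*} [CommRing R] [CommRing A] [Algebra R A] {L : R[X] →ₗ[R] R}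
    {p q : ℕ → R[X]} (hp : IsMonicOrthogonal L p) {a b : ℕ → R}
    (hpab : IsThreeTerm (fun n => C (a n)) (fun n => C (b n)) X p)
    (hqab : IsThreeTerm (fun n => C (a n)) (fun n => C (b n)) X q) (hq0 : q 0 = 0)
    (hq1 : q 1 = C (L 1)) {M : R[X] →ₗ[R] A} {x c : A}
    (hM : ∀ f, M (X * f) = x * M f + c * algebraMap R A (L f)) (n : ℕ) :
    M (p n) = aeval x (p n) * M 1 + c * aeval x (q n) := by
  have hMC : ∀ (r : R) (f : R[X]), M (C r * f) = algebraMap R A r * M f := fun r f => by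
    rw [← smul_eq_C_mul, map_smul, Algebra.smul_def]
  have haeval : ∀ {u : ℕ → R[X]}, IsThreeTerm (fun n => C (a n)) (fun n => C (b n)) X u →
      IsThreeTerm (fun n => algebraMap R A (a n)) (fun n => algebraMap R A (b n)) x
        fun n => aeval x (u n) := fun hu n => by
    simpa only [map_sub, map_mul, aeval_C, aeval_X] using congrArg (aeval x) (hu n)
  have hMp : IsThreeTerm (fun n => algebraMap R A (a n)) (fun n => algebraMap R A (b n)) x
      fun n => M (p n) := fun n => by
    have h0 : L (p (n + 1)) = 0 := by
      have := hp.map_mul_of_natDegree_le (n := n + 1) (q := 1) (by simp)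
      simpa [coeff_one] using this
    simp only [hpab n, sub_mul, map_sub, hM, hMC, h0, map_zero]
    ring
  have hp0 : p 0 = 1 := eq_one_of_monic_natDegree_zero (hp.monic 0) (hp.natDegree_eq 0)
  have hp1 : p 1 = X * 1 + C ((p 1).coeff 0) * 1 := by
    simpa using (hp.monic 1).eq_X_add_C (hp.natDegree_eq 1)
  refine hMp.ext (v := fun n => aeval x (p n) * M 1 + c * aeval x (q n)) ?_ ?_ ?_ n
  · simpa only [mul_comm] using ((haeval hpab).const_mul (M 1)).add ((haeval hqab).const_mul c)
  · simp [hp0, hq0]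
  · rw [hp1, hq1, map_add, hM, hMC]
    simp only [map_add, map_mul, aeval_X, aeval_C, map_one]
    ring

section Real

variable {L : ℝ[X] →ₗ[ℝ] ℝ} {p : ℕ → ℝ[X]}

/-- Otherwise `L (p n * q) > 0` for the cofactor `q`, although `q` has smaller degree than `p n`. -/
lemma not_dvd_of_nonneg (hp : IsMonicOrthogonal L p)
    (hL : ∀ q ≠ 0, (∀ x, 0 ≤ q.eval x) → 0 < L q) {n : ℕ} {r : ℝ[X]} (hr : ∀ x, 0 ≤ r.eval x)
    (hdeg : r.natDegree ≠ 0) : ¬ r ∣ p n := by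
  rintro ⟨q, hq⟩
  have hrq : r * q ≠ 0 := hq ▸ (hp.monic n).ne_zero
  have hlt : q.degree < n := by
    have := natDegree_mul (left_ne_zero_of_mul hrq) (right_ne_zero_of_mul hrq)
    rw [← hq, hp.natDegree_eq] at this
    rw [degree_eq_natDegree (right_ne_zero_of_mul hrq)]
    exact_mod_cast (show q.natDegree < n by omega)
  refine (hL (p n * q) ?_ fun x => ?_).ne' (hp.map_mul_eq_zero (fun _ => hp.orthogonal) hlt)
  · exact mul_ne_zero (hp.monic n).ne_zero (right_ne_zero_of_mul hrq)
  · rw [hq, eval_mul, eval_mul, mul_assoc]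
    exact mul_nonneg (hr x) (mul_self_nonneg _)

lemma im_eq_zero (hp : IsMonicOrthogonal L p) (hL : ∀ q ≠ 0, (∀ x, 0 ≤ q.eval x) → 0 < L q)
    {n : ℕ} {z : ℂ} (hz : aeval z (p n) = 0) : z.im = 0 := by
  by_contra him
  refine hp.not_dvd_of_nonneg hL (fun x => ?_) ?_
    (quadratic_dvd_of_aeval_eq_zero_im_ne_zero _ hz him)
  · have hnorm := Complex.sq_norm z
    rw [Complex.normSq_apply] at hnorm
    simp only [eval_add, eval_sub, eval_pow, eval_X, eval_mul, eval_C]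
    nlinarith [sq_nonneg (x - z.re), sq_nonneg z.im]
  · have hquad : X ^ 2 - C (2 * z.re) * X + C (‖z‖ ^ 2) =
        C 1 * X ^ 2 + C (-(2 * z.re)) * X + C (‖z‖ ^ 2) := by
      simp only [C_neg, C_1]; ring
    rw [hquad, natDegree_quadratic one_ne_zero]
    exact two_ne_zero

lemma hasSimpleZerosIn (hp : IsMonicOrthogonal L p)
    (hL : ∀ q ≠ 0, (∀ x, 0 ≤ q.eval x) → 0 < L q) (n : ℕ) :
    HasSimpleZerosIn (p n) Set.univ where
  ne_zero := (hp.monic n).ne_zero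
  splits := Splits.of_splits_map (algebraMap ℝ ℂ) (IsAlgClosed.splits _) fun z hz => by
    have hz0 : aeval z (p n) = 0 := by simpa [eval_map_algebraMap] using (mem_roots'.1 hz).2
    exact ⟨z.re, Complex.ext rfl (by simpa using (hp.im_eq_zero hL hz0).symm)⟩
  nodup_roots := by
    rw [Multiset.nodup_iff_count_le_one]
    intro x
    by_contra! hx
    rw [count_roots] at hx
    refine hp.not_dvd_of_nonneg hL (n := n) (r := (X - C x) ^ 2) (fun y => ?_) (by simp)
      ((le_rootMultiplicity_iff (hp.monic n).ne_zero).1 hx)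
    rw [eval_pow]; exact sq_nonneg _
  mem _ := Set.mem_univ _

end Real

end IsMonicOrthogonal

end Orthogonal

section MomentFunctional

open MeasureTheory

variable {g : ℕ} {α β : Fin g → ℝ}

/-- The moment functional `p ↦ ∫_E p w`, so that `⟨p, q⟩` is its value at `p q`. -/
def momentFunctional (ho : Ordered α β) : ℝ[X] →ₗ[ℝ] ℝ where
  toFun p := ∫ x in bandSet α β, p.eval x * weight α β x
  map_add' p q := by
    rw [← integral_add (ho.integrableOn_mul_weight p.continuous.continuousOn)
      (ho.integrableOn_mul_weight q.continuous.continuousOn)]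
    simp only [eval_add, add_mul]
  map_smul' c p := by
    rw [RingHom.id_apply, smul_eq_mul, ← integral_const_mul]
    simp only [eval_smul, smul_eq_mul, mul_assoc]

lemma momentFunctional_apply (ho : Ordered α β) (p : ℝ[X]) :
    momentFunctional ho p = ∫ x in bandSet α β, p.eval x * weight α β x := rfl

lemma ip_eq (ho : Ordered α β) (p q : ℝ[X]) : ip α β p q = momentFunctional ho (p * q) := by
  simp [ip, momentFunctional_apply, eval_mul]

lemma momentFunctional_pos (ho : Ordered α β) (p : ℝ[X]) (hp0 : p ≠ 0) (hp : ∀ x, 0 ≤ p.eval x) :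
    0 < momentFunctional ho p := by
  rw [momentFunctional_apply, integral_pos_iff_support_of_nonneg
    (fun x => mul_nonneg (hp x) (weight_nonneg x))
    (ho.integrableOn_mul_weight p.continuous.continuousOn)]
  have hroots : ∀ᵐ x ∂volume.restrict (bandSet α β), p.eval x ≠ 0 :=
    ae_restrict_of_ae (compl_mem_ae_iff.2 ((finite_setOfPred_isRoot hp0).measure_zero volume))
  have hsupp : Function.support (fun x => p.eval x * weight α β x) =ᵐ[volume.restrict (bandSet α β)]
      Set.univ := by
    rw [Filter.eventuallyEq_univ]
    filter_upwards [hroots, ho.ae_weight_pos] with x hx hw using mul_ne_zero hx hw.ne'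
  rw [measure_congr hsupp, Measure.restrict_apply_univ]
  exact ho.volume_bandSet_pos

lemma momentFunctional_mul_self_pos (ho : Ordered α β) (p : ℝ[X]) (hp0 : p ≠ 0) :
    0 < momentFunctional ho (p * p) :=
  momentFunctional_pos ho _ (mul_ne_zero hp0 hp0) fun x => by
    rw [eval_mul]; exact mul_self_nonneg _

lemma momentFunctional_mono (ho : Ordered α β) {p q : ℝ[X]}
    (hpq : ∀ x ∈ Set.Icc (-1 : ℝ) 1, p.eval x ≤ q.eval x) :
    momentFunctional ho p ≤ momentFunctional ho q :=
  setIntegral_mono_on (ho.integrableOn_mul_weight p.continuous.continuousOn)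
    (ho.integrableOn_mul_weight q.continuous.continuousOn) measurableSet_bandSet fun x hx =>
      mul_le_mul_of_nonneg_right (hpq x (ho.bandSet_subset hx)) (weight_nonneg x)

end MomentFunctional

section FirstKind

variable {g : ℕ} {α β : Fin g → ℝ}

lemma P_eq (n : ℕ) : P α β n = X ^ n - ∑ k ∈ Finset.range n,
    C (ip α β (X ^ n) (P α β k) / ip α β (P α β k) (P α β k)) * P α β k := by
  rw [P, Finset.sum_range]

@[simp] lemma P_zero : P α β 0 = 1 := by rw [P_eq]; simp

lemma monic_natDegree_P (n : ℕ) : (P α β n).Monic ∧ (P α β n).natDegree = n := by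
  induction n using Nat.strong_induction_on with
  | _ n ih =>
    have hlt : (∑ k ∈ Finset.range n,
        C (ip α β (X ^ n) (P α β k) / ip α β (P α β k) (P α β k)) * P α β k).degree < n := by
      refine (degree_sum_le _ _).trans_lt ((Finset.sup_lt_iff (WithBot.bot_lt_coe n)).2 ?_)
      intro k hk
      have hk := Finset.mem_range.1 hk
      rw [← smul_eq_C_mul]
      refine (degree_smul_le _ _).trans_lt ?_
      rw [degree_eq_natDegree (ih k hk).1.ne_zero, (ih k hk).2]
      exact WithBot.coe_lt_coe.2 hk
    rw [P_eq]
    refine ⟨monic_X_pow_sub hlt, natDegree_eq_of_degree_eq_some ?_⟩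
    rw [degree_sub_eq_left_of_degree_lt (by rwa [degree_X_pow]), degree_X_pow]

lemma monic_P (n : ℕ) : (P α β n).Monic := (monic_natDegree_P n).1

@[simp] lemma natDegree_P (n : ℕ) : (P α β n).natDegree = n := (monic_natDegree_P n).2

lemma h_eq (ho : Ordered α β) (n : ℕ) :
    h α β n = momentFunctional ho (P α β n * P α β n) := ip_eq ho _ _

lemma h_pos (ho : Ordered α β) (n : ℕ) : 0 < h α β n := by
  rw [h_eq ho]; exact momentFunctional_mul_self_pos ho _ (monic_P n).ne_zero

lemma isMonicOrthogonal_P (ho : Ordered α β) :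
    IsMonicOrthogonal (momentFunctional ho) (P α β) where
  monic := monic_P
  natDegree_eq := natDegree_P
  orthogonal {n k} hk := by
    induction n using Nat.strong_induction_on generalizing k with
    | _ n ih =>
      have hne : ∀ i < n, i ≠ k → momentFunctional ho (P α β i * P α β k) = 0 := by
        intro i hi hik
        rcases hik.lt_or_gt with h | h
        · rw [mul_comm]; exact ih k hk h
        · exact ih i hi h
      rw [P_eq n, sub_mul, map_sub, Finset.sum_mul, map_sum, Finset.sum_eq_single k]
      · rw [mul_assoc, linearMap_C_mul, ip_eq ho, ip_eq ho, ← h_eq,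
          div_mul_cancel₀ _ (h_pos ho k).ne', sub_self]
      · intro i hi hik
        rw [mul_assoc, linearMap_C_mul, hne i (Finset.mem_range.1 hi) hik, mul_zero]
      · exact fun h => absurd (Finset.mem_range.2 hk) h

lemma hasSimpleZerosIn_P (ho : Ordered α β) (n : ℕ) : HasSimpleZerosIn (P α β n) Set.univ :=
  (isMonicOrthogonal_P ho).hasSimpleZerosIn (momentFunctional_pos ho) n

lemma isThreeTerm_P (ho : Ordered α β) :
    IsThreeTerm (fun n => C (recA α β n)) (fun n => C (recB α β n)) X (P α β) := fun n => by
  have hX := (isMonicOrthogonal_P ho).X_mul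
    (fun q hq => (momentFunctional_mul_self_pos ho q hq).ne') n
  rw [← ip_eq, ← h_eq, ← h_eq] at hX
  simp only [recA, recB, show n + 2 - 1 = n + 1 from rfl, Nat.add_sub_cancel]
  linear_combination -hX

lemma recA_pos (ho : Ordered α β) (n : ℕ) : 0 < recA α β n := div_pos (h_pos ho _) (h_pos ho _)

lemma h_succ (ho : Ordered α β) (n : ℕ) : h α β (n + 1) = recA α β (n + 1) * h α β n := by
  rw [recA, Nat.add_sub_cancel, div_mul_cancel₀ _ (h_pos ho n).ne']

/-- `h (n + 1) = ⟨x Pₙ, Pₙ₊₁⟩ = ⟨x Pₙ, x Pₙ⟩ - …`, and `x² ≤ 1` on `E`. -/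
lemma h_antitone (ho : Ordered α β) : Antitone (h α β) := antitone_nat_of_succ_le fun n => by
  set L := momentFunctional ho
  have hp := isMonicOrthogonal_P ho
  have hX : L (P α β (n + 1) * (X * P α β n)) = h α β (n + 1) := by
    rw [hp.map_mul_of_natDegree_le, coeff_X_mul, hp.coeff_self, one_mul, h_eq ho]
    exact (natDegree_mul_le_of_le natDegree_X_le (natDegree_P n).le).trans (by omega)
  have hsq : 0 ≤ L ((X * P α β n - P α β (n + 1)) * (X * P α β n - P α β (n + 1))) := by
    by_cases h0 : X * P α β n - P α β (n + 1) = 0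
    · simp [h0]
    · exact (momentFunctional_mul_self_pos ho _ h0).le
  have hle : L (X * P α β n * (X * P α β n)) ≤ h α β n := by
    rw [h_eq ho]
    refine momentFunctional_mono ho fun x hx => ?_
    have hx2 : x ^ 2 ≤ 1 := by nlinarith [hx.1, hx.2]
    simp only [eval_mul, eval_X]
    nlinarith [mul_self_nonneg ((P α β n).eval x)]
  rw [show (X * P α β n - P α β (n + 1)) * (X * P α β n - P α β (n + 1)) =
      X * P α β n * (X * P α β n) - P α β (n + 1) * (X * P α β n) -
        P α β (n + 1) * (X * P α β n) + P α β (n + 1) * P α β (n + 1) by ring, map_add, map_sub,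
    map_sub, hX, ← h_eq] at hsq
  linarith

end FirstKind

section SecondKind

open MeasureTheory

variable {g : ℕ} {α β : Fin g → ℝ}

/-- The polynomials of the second kind as elements of `ℝ[X]`, defined by their three-term
recurrence. -/
def secondPoly (α β : Fin g → ℝ) : ℕ → ℝ[X]
  | 0 => 0
  | 1 => C (h α β 0)
  | n + 2 => (X - C (recB α β (n + 2))) * secondPoly α β (n + 1) -
      C (recA α β (n + 1)) * secondPoly α β n

@[simp] lemma secondPoly_zero : secondPoly α β 0 = 0 := by rw [secondPoly]

@[simp] lemma secondPoly_one : secondPoly α β 1 = C (h α β 0) := by rw [secondPoly]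

lemma isThreeTerm_secondPoly :
    IsThreeTerm (fun n => C (recA α β n)) (fun n => C (recB α β n)) X (secondPoly α β) :=
  fun n => by rw [secondPoly]

lemma P_mul_secondPoly_sub (ho : Ordered α β) (n : ℕ) :
    P α β n * secondPoly α β (n + 1) - P α β (n + 1) * secondPoly α β n = C (h α β n) := by
  induction n with
  | zero => simp
  | succ n ih =>
    rw [(isThreeTerm_P ho).casoratian_succ isThreeTerm_secondPoly, ih, h_succ ho, C_mul]

lemma h_zero (ho : Ordered α β) : h α β 0 = momentFunctional ho 1 := by simp [h_eq ho]

lemma ae_sub_ofReal_ne_zero (μ : Measure ℝ) [NullSingletonClass μ] (z : ℂ) :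
    ∀ᵐ t : ℝ ∂μ, z - t ≠ 0 := by
  filter_upwards [Measure.ae_ne μ z.re] with t ht h
  exact ht (by rw [sub_eq_zero.1 h, Complex.ofReal_re])

lemma Ordered.integrableOn_divDiff (ho : Ordered α β) (p : ℝ[X]) (z : ℂ) :
    IntegrableOn (fun t : ℝ => (aeval z p - p.eval t) / (z - t) * weight α β t)
      (bandSet α β) := by
  obtain ⟨q, hq⟩ := dvd_iff_isRoot.2 (show (p.map (algebraMap ℝ ℂ) - C (aeval z p)).IsRoot z by
    simp [eval_map_algebraMap])
  have hw : IntegrableOn (fun t => (weight α β t : ℂ)) (bandSet α β) :=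
    ho.integrableOn_weight.ofReal
  refine (hw.continuousOn_mul (g := fun t : ℝ => q.eval (t : ℂ))
    (q.continuous.comp Complex.continuous_ofReal).continuousOn isCompact_bandSet).congr ?_
  filter_upwards [ae_sub_ofReal_ne_zero _ z] with t ht
  have hqt := congrArg (eval (t : ℂ)) hq
  simp only [eval_sub, eval_mul, eval_X, eval_C, eval_map_algebraMap] at hqt
  have hpt : aeval (t : ℂ) p = p.eval t := by
    rw [← Complex.coe_algebraMap, aeval_algebraMap_apply, coe_aeval_eq_eval]
  rw [hpt] at hqt
  congr 1
  rw [eq_div_iff ht]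
  linear_combination hqt

/-- The functional `p ↦ ∫_E (p(z) - p(t)) / (z - t) w(t) dt`, whose value at `P_n` is `Q_n(z)`. -/
def divDiffFunctional (ho : Ordered α β) (z : ℂ) : ℝ[X] →ₗ[ℝ] ℂ where
  toFun p := ∫ t in bandSet α β, (aeval z p - p.eval t) / (z - t) * weight α β t
  map_add' p q := by
    rw [← integral_add (ho.integrableOn_divDiff p z) (ho.integrableOn_divDiff q z)]
    congr 1 with t
    simp only [map_add, eval_add, Complex.ofReal_add]
    ring
  map_smul' c p := by
    rw [RingHom.id_apply, Complex.real_smul, ← integral_const_mul]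
    congr 1 with t
    simp only [map_smul, eval_smul, smul_eq_mul, Complex.real_smul, Complex.ofReal_mul]
    ring

lemma divDiffFunctional_apply (ho : Ordered α β) (z : ℂ) (p : ℝ[X]) : divDiffFunctional ho z p =
    ∫ t in bandSet α β, (aeval z p - p.eval t) / (z - t) * weight α β t := rfl

lemma divDiffFunctional_X_mul (ho : Ordered α β) (z : ℂ) (p : ℝ[X]) :
    divDiffFunctional ho z (X * p) = z * divDiffFunctional ho z p + momentFunctional ho p := by
  have hp : IntegrableOn (fun t => ((p.eval t * weight α β t : ℝ) : ℂ)) (bandSet α β) :=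
    (ho.integrableOn_mul_weight p.continuous.continuousOn).ofReal
  rw [momentFunctional_apply, divDiffFunctional_apply, divDiffFunctional_apply,
    ← integral_const_mul, ← integral_complex_ofReal,
    ← integral_add ((ho.integrableOn_divDiff p z).const_mul z) hp]
  refine integral_congr_ae ?_
  filter_upwards [ae_sub_ofReal_ne_zero _ z] with t ht
  simp only [map_mul, aeval_X, eval_mul, eval_X, Complex.ofReal_mul]
  field_simp
  ring

lemma Q_eq_aeval (ho : Ordered α β) (n : ℕ) (z : ℂ) : Q α β n z = aeval z (secondPoly α β n) := by
  have h1 : divDiffFunctional ho z 1 = 0 := by simp [divDiffFunctional_apply]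
  have h := (isMonicOrthogonal_P ho).map_eq (isThreeTerm_P ho) isThreeTerm_secondPoly
    secondPoly_zero (h_zero ho ▸ secondPoly_one) (M := divDiffFunctional ho z) (x := z) (c := 1)
    (fun f => by rw [divDiffFunctional_X_mul, one_mul, Complex.coe_algebraMap]) n
  rwa [h1, mul_zero, zero_add, one_mul] at h

lemma Ordered.integrableOn_div (ho : Ordered α β) (p : ℝ[X]) {x : ℝ} (hx : 1 < x) :
    IntegrableOn (fun t => p.eval t / (x - t) * weight α β t) (bandSet α β) :=
  ho.integrableOn_mul_weight <| p.continuous.continuousOn.div (by fun_prop) fun t ht =>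
    (sub_pos.2 ((ho.bandSet_subset ht).2.trans_lt hx)).ne'

/-- The functional `p ↦ ∫_E p(t) / (x - t) w(t) dt` for `x > 1`. -/
def cauchyFunctional (ho : Ordered α β) {x : ℝ} (hx : 1 < x) : ℝ[X] →ₗ[ℝ] ℝ where
  toFun p := ∫ t in bandSet α β, p.eval t / (x - t) * weight α β t
  map_add' p q := by
    rw [← integral_add (ho.integrableOn_div p hx) (ho.integrableOn_div q hx)]
    simp only [eval_add, add_div, add_mul]
  map_smul' c p := by
    rw [RingHom.id_apply, smul_eq_mul, ← integral_const_mul]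
    simp only [eval_smul, smul_eq_mul, mul_div_assoc, mul_assoc]

lemma cauchyFunctional_apply (ho : Ordered α β) {x : ℝ} (hx : 1 < x) (p : ℝ[X]) :
    cauchyFunctional ho hx p = ∫ t in bandSet α β, p.eval t / (x - t) * weight α β t := rfl

lemma cauchyFunctional_X_mul (ho : Ordered α β) {x : ℝ} (hx : 1 < x) (p : ℝ[X]) :
    cauchyFunctional ho hx (X * p) = x * cauchyFunctional ho hx p - momentFunctional ho p := by
  rw [momentFunctional_apply, cauchyFunctional_apply, cauchyFunctional_apply, ← integral_const_mul,
    ← integral_sub ((ho.integrableOn_div p hx).const_mul x)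
      (ho.integrableOn_mul_weight p.continuous.continuousOn)]
  refine setIntegral_congr_fun measurableSet_bandSet fun t ht => ?_
  have hxt : x - t ≠ 0 := (sub_pos.2 ((ho.bandSet_subset ht).2.trans_lt hx)).ne'
  simp only [eval_mul, eval_X]
  field_simp
  ring

/-- AM–GM for `|p| / s` and `s`, where `s ^ 2 = ∫ p ^ 2 w`. -/
lemma Ordered.integral_abs_mul_weight_le (ho : Ordered α β) {p : ℝ[X]} (hp : p ≠ 0) :
    ∫ t in bandSet α β, |p.eval t| * weight α β t ≤
      √(momentFunctional ho (p * p)) * ((1 + h α β 0) / 2) := by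
  set s := √(momentFunctional ho (p * p)) with hs
  have hpp := momentFunctional_mul_self_pos ho p hp
  have hs0 : 0 < s := Real.sqrt_pos.2 hpp
  calc ∫ t in bandSet α β, |p.eval t| * weight α β t
      ≤ momentFunctional ho (C (1 / (2 * s)) * (p * p) + C (s / 2)) := by
        refine setIntegral_mono (ho.integrableOn_mul_weight p.continuous.abs.continuousOn)
          (ho.integrableOn_mul_weight (Polynomial.continuous _).continuousOn) fun t => ?_
        refine mul_le_mul_of_nonneg_right ?_ (weight_nonneg t)
        have hsq : 0 ≤ (|p.eval t| - s) ^ 2 / (2 * s) := by positivity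
        rw [sub_sq, sq_abs] at hsq
        simp only [eval_add, eval_mul, eval_C]
        calc |p.eval t| ≤ |p.eval t| +
              (p.eval t ^ 2 - 2 * |p.eval t| * s + s ^ 2) / (2 * s) := le_add_of_nonneg_right hsq
          _ = 1 / (2 * s) * (p.eval t * p.eval t) + s / 2 := by field_simp; ring
    _ = s * ((1 + h α β 0) / 2) := by
        rw [map_add, linearMap_C_mul, ← mul_one (C (s / 2)), linearMap_C_mul, ← h_zero ho,
          ← Real.mul_self_sqrt hpp.le, ← hs]
        field_simp

lemma abs_cauchyFunctional_le (ho : Ordered α β) {x : ℝ} (hx : 1 < x) (p : ℝ[X]) :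
    |cauchyFunctional ho hx p| ≤ (∫ t in bandSet α β, |p.eval t| * weight α β t) / (x - 1) := by
  rw [cauchyFunctional_apply, ← integral_div, ← Real.norm_eq_abs]
  refine norm_integral_le_of_norm_le
    ((ho.integrableOn_mul_weight p.continuous.abs.continuousOn).div_const _) ?_
  rw [ae_restrict_iff' measurableSet_bandSet]
  refine Filter.Eventually.of_forall fun t ht => ?_
  have ht1 := (ho.bandSet_subset ht).2
  have : 0 < x - 1 := sub_pos.2 hx
  rw [Real.norm_eq_abs, abs_mul, abs_of_nonneg (weight_nonneg t), abs_div,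
    abs_of_pos (by linarith : 0 < x - t), mul_div_right_comm]
  gcongr
  exact weight_nonneg t

/-- The functions of the second kind `ψ_n(x) = ∫_E P_n(t) / (x - t) w(t) dt`, for `x > 1`. -/
def psi (α β : Fin g → ℝ) (n : ℕ) (x : ℝ) : ℝ :=
  ∫ t in bandSet α β, (P α β n).eval t / (x - t) * weight α β t

lemma psi_eq (ho : Ordered α β) (n : ℕ) {x : ℝ} (hx : 1 < x) :
    psi α β n x = (P α β n).eval x * psi α β 0 x - (secondPoly α β n).eval x := by
  have h := (isMonicOrthogonal_P ho).map_eq (isThreeTerm_P ho) isThreeTerm_secondPoly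
    secondPoly_zero (h_zero ho ▸ secondPoly_one) (M := cauchyFunctional ho hx) (x := x) (c := -1)
    (fun f => by rw [cauchyFunctional_X_mul, neg_one_mul, sub_eq_add_neg, Algebra.algebraMap_self,
      RingHom.id_apply]) n
  simpa [psi, cauchyFunctional_apply, ← sub_eq_add_neg, coe_aeval_eq_eval] using h

lemma isThreeTerm_psi (ho : Ordered α β) {x : ℝ} (hx : 1 < x) :
    IsThreeTerm (recA α β) (recB α β) x fun n => psi α β n x := by
  have heval {u : ℕ → ℝ[X]}
      (hu : IsThreeTerm (fun n => C (recA α β n)) (fun n => C (recB α β n)) X u) :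
      IsThreeTerm (recA α β) (recB α β) x fun n => (u n).eval x := by
    simpa only [coe_evalRingHom, eval_C, eval_X] using hu.map (evalRingHom x)
  have h := ((heval (isThreeTerm_P ho)).const_mul (psi α β 0 x)).sub (heval isThreeTerm_secondPoly)
  intro n
  beta_reduce
  rw [psi_eq ho (n + 2) hx, psi_eq ho (n + 1) hx, psi_eq ho n hx]
  linear_combination h n

lemma pow_mul_psi (ho : Ordered α β) {n j : ℕ} (hj : j ≤ n) {x : ℝ} (hx : 1 < x) :
    x ^ j * psi α β n x = cauchyFunctional ho hx (X ^ j * P α β n) := by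
  induction j with
  | zero => simp [psi, cauchyFunctional_apply]
  | succ j ih =>
    have hp := isMonicOrthogonal_P ho
    rw [pow_succ' X, mul_assoc, cauchyFunctional_X_mul, ← ih (by omega), mul_comm (X ^ j),
      hp.map_mul_of_natDegree_le (by simpa using hj.trans' j.le_succ), coeff_X_pow,
      if_neg (by omega)]
    ring

lemma abs_psi_le (ho : Ordered α β) (n : ℕ) {x : ℝ} (hx : 1 < x) :
    |psi α β n x| ≤ √(h α β n) * ((1 + h α β 0) / 2) / (x - 1) / x ^ n := by
  have hx0 : 0 < x := by linarith
  have : 0 < x - 1 := sub_pos.2 hx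
  rw [le_div_iff₀' (by positivity)]
  calc x ^ n * |psi α β n x| = |cauchyFunctional ho hx (X ^ n * P α β n)| := by
        rw [← pow_mul_psi ho le_rfl hx, abs_mul, abs_of_pos (pow_pos hx0 n)]
    _ ≤ (∫ t in bandSet α β, |(X ^ n * P α β n).eval t| * weight α β t) / (x - 1) :=
        abs_cauchyFunctional_le ho hx _
    _ ≤ (∫ t in bandSet α β, |(P α β n).eval t| * weight α β t) / (x - 1) := by
        gcongr ?_ / _
        refine setIntegral_mono_on
          (ho.integrableOn_mul_weight (Polynomial.continuous _).abs.continuousOn)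
          (ho.integrableOn_mul_weight (Polynomial.continuous _).abs.continuousOn)
          measurableSet_bandSet fun t ht => ?_
        refine mul_le_mul_of_nonneg_right ?_ (weight_nonneg t)
        rw [eval_mul, eval_pow, eval_X, abs_mul, abs_pow]
        exact mul_le_of_le_one_left (abs_nonneg _)
          (pow_le_one₀ (abs_nonneg t) (abs_le.2 (ho.bandSet_subset ht)))
    _ ≤ √(h α β n) * ((1 + h α β 0) / 2) / (x - 1) := by
        rw [h_eq ho n]
        gcongr
        exact ho.integral_abs_mul_weight_le (monic_P n).ne_zero

end SecondKind

section HalfPlane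

open MeasureTheory Filter Topology Complex

lemma tendsto_ofReal_add_mul_I (x : ℝ) :
    Tendsto (fun ε : ℝ => (x + ε * I : ℂ)) (𝓝[>] 0) (𝓝[{z | 0 ≤ z.im}] x) := by
  refine tendsto_nhdsWithin_iff.2 ⟨Tendsto.mono_left ?_ nhdsWithin_le_nhds, ?_⟩
  · exact Continuous.tendsto' (by fun_prop) _ _ (by simp)
  · filter_upwards [self_mem_nhdsWithin] with ε (hε : 0 < ε)
    simpa using hε.le

/-- `f` is holomorphic in the upper half-plane and has the boundary values `V` on the real line;
the convergence is dominated by a locally integrable function. -/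
structure HasBoundaryValues (f : ℂ → ℂ) (V : ℝ → ℂ) : Prop where
  differentiableOn : DifferentiableOn ℂ f {z | 0 < z.im}
  tendsto : ∀ᵐ x : ℝ, Tendsto (fun ε : ℝ => f (x + ε * I)) (𝓝[>] 0) (𝓝 (V x))
  dominated : ∃ φ : ℝ → ℝ, (∀ a b, IntervalIntegrable φ volume a b) ∧
    ∀ᶠ ε : ℝ in 𝓝[>] 0, ∀ᵐ x : ℝ, ‖f (x + ε * I)‖ ≤ φ x

variable {f k : ℂ → ℂ} {V W : ℝ → ℂ}

lemma HasBoundaryValues.sub (hf : HasBoundaryValues f V) (hk : HasBoundaryValues k W) :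
    HasBoundaryValues (fun z => f z - k z) fun x => V x - W x where
  differentiableOn := hf.differentiableOn.sub hk.differentiableOn
  tendsto := by filter_upwards [hf.tendsto, hk.tendsto] with x hx hx' using hx.sub hx'
  dominated := by
    obtain ⟨φ, hφ, hfφ⟩ := hf.dominated
    obtain ⟨χ, hχ, hkχ⟩ := hk.dominated
    refine ⟨fun x => φ x + χ x, fun a b => (hφ a b).add (hχ a b), ?_⟩
    filter_upwards [hfφ, hkχ] with ε hε hε'
    filter_upwards [hε, hε'] with x hx hx' using (norm_sub_le _ _).trans (add_le_add hx hx')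

lemma exists_norm_div_sub_le {y : ℂ} (hf : DifferentiableAt ℂ f y) (hy : f y = 0) :
    ∃ M δ : ℝ, 0 < δ ∧ ∀ z, ‖z - y‖ < δ → ‖f z / (z - y)‖ ≤ M := by
  have hO := hf.isBigO_sub
  simp only [hy, sub_zero] at hO
  obtain ⟨M, hM0, hM⟩ := hO.exists_nonneg
  obtain ⟨δ, hδ, hball⟩ := Metric.eventually_nhds_iff.1 hM.bound
  refine ⟨M, δ, hδ, fun z hz => ?_⟩
  rw [norm_div]
  exact div_le_of_le_mul₀ (norm_nonneg _) hM0 (hball (by rwa [dist_eq]))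

lemma HasBoundaryValues.div_sub (hf : HasBoundaryValues f V) {y : ℝ}
    (hdiff : DifferentiableAt ℂ f y) (hy : f y = 0) :
    HasBoundaryValues (fun z => f z / (z - y)) fun x => V x / (x - y) where
  differentiableOn := hf.differentiableOn.div (by fun_prop) fun z (hz : 0 < z.im) h => by
    have := congrArg im h
    simp only [sub_im, ofReal_im, sub_zero, zero_im] at this
    exact hz.ne' this
  tendsto := by
    filter_upwards [hf.tendsto, Measure.ae_ne volume y] with x hx hxy
    exact hx.div (((tendsto_ofReal_add_mul_I x).mono_right nhdsWithin_le_nhds).sub_const _)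
      (sub_ne_zero.2 (by exact_mod_cast hxy))
  dominated := by
    obtain ⟨φ, hφ, hfφ⟩ := hf.dominated
    obtain ⟨M, δ, hδ, hM⟩ := exists_norm_div_sub_le hdiff hy
    refine ⟨fun x => |M| + φ x * δ⁻¹,
      fun a b => intervalIntegrable_const.add ((hφ a b).mul_const _), ?_⟩
    filter_upwards [hfφ] with ε hε
    filter_upwards [hε] with x hx
    have hφ0 : 0 ≤ φ x := (norm_nonneg _).trans hx
    rcases lt_or_ge ‖(x + ε * I : ℂ) - y‖ δ with hlt | hge
    · exact (hM _ hlt).trans ((le_abs_self M).trans (le_add_of_nonneg_right (by positivity)))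
    · rw [norm_div, div_eq_mul_inv]
      exact (mul_le_mul hx (inv_anti₀ hδ hge) (by positivity) hφ0).trans
        (le_add_of_nonneg_left (abs_nonneg M))

lemma norm_integral_line_le (hf : DifferentiableOn ℂ f {z | 0 < z.im}) {L M ε : ℝ} (hε : 0 < ε)
    (hεL : ε < L) (hM : ∀ z : ℂ, 0 < z.im → L ≤ ‖z‖ → ‖f z‖ ≤ M) :
    ‖∫ x : ℝ in (-L)..L, f (x + ε * I)‖ ≤ 4 * L * M := by
  have hL : 0 < L := hε.trans hεL
  have hrect := integral_boundary_rect_eq_zero_of_differentiableOn f (⟨-L, ε⟩ : ℂ) (⟨L, L⟩ : ℂ)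
    (hf.mono fun z hz => by
      have := hz.2
      simp only [Set.mem_preimage, Set.uIcc_of_le hεL.le] at this
      exact hε.trans_le this.1)
  simp only at hrect
  have htop : ‖∫ x : ℝ in (-L)..L, f (x + L * I)‖ ≤ M * |L - -L| := by
    refine intervalIntegral.norm_integral_le_of_norm_le_const fun x _ => hM _ (by simpa) ?_
    refine le_trans ?_ (abs_im_le_norm _)
    simp [abs_of_pos hL]
  have hside : ∀ c : ℝ, |c| = L → ‖I • ∫ y : ℝ in ε..L, f (c + y * I)‖ ≤ M * |L - ε| := by
    intro c hc
    rw [norm_smul, norm_I, one_mul]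
    refine intervalIntegral.norm_integral_le_of_norm_le_const fun y hy => hM _ ?_ ?_
    · rw [Set.uIoc_of_le hεL.le] at hy
      simpa using hε.trans hy.1
    · refine le_trans ?_ (abs_re_le_norm _)
      simp [hc]
  have hright := hside L (abs_of_pos hL)
  have hleft := hside (-L) (by rw [abs_neg, abs_of_pos hL])
  have hM0 : 0 ≤ M := (norm_nonneg _).trans (hM (L * I) (by simpa) (by simp [abs_of_pos hL]))
  rw [abs_of_pos (by linarith)] at htop hright hleft
  have hε : 0 ≤ M * ε := by positivity
  calc ‖∫ x : ℝ in (-L)..L, f (x + ε * I)‖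
      = ‖(∫ x : ℝ in (-L)..L, f (x + L * I)) - I • (∫ y : ℝ in ε..L, f ((L : ℝ) + y * I)) +
          I • (∫ y : ℝ in ε..L, f ((-L : ℝ) + y * I))‖ := by
        congr 1
        linear_combination hrect
    _ ≤ M * (L - -L) + M * (L - ε) + M * (L - ε) :=
        norm_add_le_of_le (norm_sub_le_of_le htop hright) hleft
    _ ≤ 4 * L * M := by linarith

lemma HasBoundaryValues.abs_integral_im_le (hf : HasBoundaryValues f V) {L M : ℝ} (hL : 0 < L)
    (hM : ∀ z : ℂ, 0 < z.im → L ≤ ‖z‖ → ‖f z‖ ≤ M) :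
    |∫ x in (-L)..L, (V x).im| ≤ 4 * L * M := by
  obtain ⟨φ, hφ, hfφ⟩ := hf.dominated
  have hcont : ∀ ε : ℝ, 0 < ε → Continuous fun x : ℝ => f (x + ε * I) := fun ε hε =>
    hf.differentiableOn.continuousOn.comp_continuous (by fun_prop) fun x => by simpa using hε
  have hlim : Tendsto (fun ε : ℝ => ∫ x in (-L)..L, (f (x + ε * I)).im) (𝓝[>] 0)
      (𝓝 (∫ x in (-L)..L, (V x).im)) := by
    refine intervalIntegral.tendsto_integral_filter_of_dominated_convergence φ ?_ ?_ (hφ _ _) ?_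
    · filter_upwards [self_mem_nhdsWithin] with ε hε
      exact (continuous_im.comp (hcont ε hε)).aestronglyMeasurable
    · filter_upwards [hfφ] with ε hε
      filter_upwards [hε] with x hx _ using (abs_im_le_norm _).trans hx
    · filter_upwards [hf.tendsto] with x hx _ using (continuous_im.tendsto _).comp hx
  refine le_of_tendsto hlim.abs ?_
  filter_upwards [Ioo_mem_nhdsGT hL] with ε hε
  have him : ∫ x in (-L)..L, (f (x + ε * I)).im = (∫ x : ℝ in (-L)..L, f (x + ε * I)).im :=
    imCLM.intervalIntegral_comp_comm ((hcont ε hε.1).intervalIntegrable _ _)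
  rw [him]
  exact (abs_im_le_norm _).trans (norm_integral_line_le hf.differentiableOn hε.1 hε.2 hM)

lemma HasBoundaryValues.integral_im_eq_zero (hf : HasBoundaryValues f V) {B R : ℝ} (hB : 0 ≤ B)
    (hdecay : ∀ z : ℂ, 0 < z.im → R ≤ ‖z‖ → ‖f z‖ ≤ B / ‖z‖ ^ 2)
    (hint : Integrable fun x => (V x).im) : ∫ x, (V x).im = 0 := by
  refine tendsto_nhds_unique
    (intervalIntegral_tendsto_integral hint tendsto_neg_atTop_atBot tendsto_id) ?_
  have hbound : ∀ L : ℝ, 0 < L → R ≤ L → |∫ x in (-L)..L, (V x).im| ≤ 4 * B / L := fun L hL hR => by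
    have h := hf.abs_integral_im_le hL (M := B / L ^ 2) fun z hz hLz =>
      (hdecay z hz (hR.trans hLz)).trans (by gcongr)
    rwa [show 4 * L * (B / L ^ 2) = 4 * B / L by field_simp] at h
  refine squeeze_zero_norm' (a := fun L => 4 * B / L) ?_
    (tendsto_const_nhds.div_atTop tendsto_id)
  filter_upwards [eventually_gt_atTop 0, eventually_ge_atTop R] with L hL hR using hbound L hL hR

lemma sub_add_I_ne_zero {z : ℂ} (hz : 0 ≤ z.im) (y : ℝ) : z - y + I ≠ 0 := fun h => by
  have := congrArg im h
  simp only [add_im, sub_im, ofReal_im, I_im, zero_im] at this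
  linarith

lemma hasBoundaryValues_cauchyKernel (c y : ℝ) :
    HasBoundaryValues (fun z => c * (I / (z - y + I))) fun x => c * (I / (x - y + I)) where
  differentiableOn z (hz : 0 < z.im) := by
    have := sub_add_I_ne_zero hz.le y
    fun_prop (disch := assumption)
  tendsto := .of_forall fun x => by
    have := sub_add_I_ne_zero (z := x) (by simp) y
    have hcont : ContinuousAt (fun z : ℂ => c * (I / (z - y + I))) x := by
      fun_prop (disch := assumption)
    exact hcont.tendsto.comp ((tendsto_ofReal_add_mul_I x).mono_right nhdsWithin_le_nhds)
  dominated := by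
    refine ⟨fun _ => |c|, fun a b => intervalIntegrable_const, ?_⟩
    filter_upwards [self_mem_nhdsWithin] with ε (hε : 0 < ε)
    refine .of_forall fun x => ?_
    have hge : 1 ≤ ‖(x + ε * I : ℂ) - y + I‖ := by
      refine le_trans ?_ (abs_im_le_norm _)
      refine le_trans ?_ (le_abs_self _)
      simp [hε.le]
    rw [norm_mul, norm_div, norm_I, norm_real, Real.norm_eq_abs]
    exact mul_le_of_le_one_right (abs_nonneg c) ((div_le_one₀ (one_pos.trans_le hge)).2 hge)

lemma im_sub_cauchyKernel_div {c x y : ℝ} (hxy : x ≠ y) (w : ℂ) :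
    ((w - c * (I / (x - y + I))) / (x - y)).im = w.im / (x - y) - c * (1 + (x - y) ^ 2)⁻¹ := by
  have hsq : (1 + ((x : ℂ) - y) ^ 2) ≠ 0 := by exact_mod_cast (by positivity : 1 + (x - y) ^ 2 ≠ 0)
  have hkernel : I / ((x : ℂ) - y + I) =
      (((1 + (x - y) ^ 2)⁻¹ : ℝ) : ℂ) * (1 + ((x - y : ℝ) : ℂ) * I) := by
    rw [div_eq_iff (sub_add_I_ne_zero (by simp) y)]
    push_cast
    field_simp
    linear_combination (-(x : ℂ) + y) * I_sq
  have hxy : x - y ≠ 0 := sub_ne_zero.2 hxy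
  rw [hkernel, ← ofReal_sub, div_ofReal_im, sub_im, im_ofReal_mul, im_ofReal_mul, add_im, one_im,
    im_ofReal_mul, I_im]
  field_simp
  ring

lemma norm_sub_cauchyKernel_div_le {A R : ℝ}
    (hdecay : ∀ z : ℂ, 0 < z.im → R ≤ ‖z‖ → ‖f z‖ ≤ A / ‖z‖) (c y : ℝ) {z : ℂ} (hz : 0 < z.im)
    (hR : max R (2 * (|y| + 1)) ≤ ‖z‖) :
    ‖(f z - c * (I / (z - y + I))) / (z - y)‖ ≤ 2 * (A + 2 * |c|) / ‖z‖ ^ 2 := by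
  obtain ⟨hR, hy⟩ := max_le_iff.1 hR
  have hz0 : 0 < ‖z‖ := by linarith [abs_nonneg y]
  have hy' : ‖(y : ℂ)‖ = |y| := by rw [norm_real, Real.norm_eq_abs]
  have hsub : ‖z‖ / 2 ≤ ‖z - y‖ := le_trans (by rw [hy']; linarith) (norm_sub_norm_le _ _)
  have hsubI : ‖z‖ / 2 ≤ ‖z - y + I‖ := by
    have hyI : ‖(y : ℂ) - I‖ ≤ |y| + 1 := norm_sub_le_of_le hy'.le norm_I.le
    rw [show z - y + I = z - (y - I) by ring]
    exact le_trans (by linarith) (norm_sub_norm_le _ _)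
  have hA : 0 ≤ A / ‖z‖ := (norm_nonneg _).trans (hdecay z hz hR)
  rw [norm_div]
  calc ‖f z - c * (I / (z - y + I))‖ / ‖z - y‖
      ≤ (A / ‖z‖ + |c| * (1 / (‖z‖ / 2))) / (‖z‖ / 2) := by
        gcongr
        refine norm_sub_le_of_le (hdecay z hz hR) ?_
        rw [norm_mul, norm_div, norm_I, norm_real, Real.norm_eq_abs]
        gcongr
    _ = 2 * (A + 2 * |c|) / ‖z‖ ^ 2 := by field_simp

/-- The pole of `f z / (z - y)` is removed by subtracting a multiple of `i / (z - y + i)`, whose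
boundary values have imaginary part `(x - y) / (1 + (x - y)²)`. -/
theorem HasBoundaryValues.integral_im_div_sub (hf : HasBoundaryValues f V) {A R c y : ℝ}
    (hA : 0 ≤ A) (hdecay : ∀ z : ℂ, 0 < z.im → R ≤ ‖z‖ → ‖f z‖ ≤ A / ‖z‖)
    (hdiff : DifferentiableAt ℂ f y) (hc : f y = c)
    (hint : Integrable fun x => (V x).im / (x - y)) :
    ∫ x, (V x).im / (x - y) = c * Real.pi := by
  have hne : (y : ℂ) - y + I ≠ 0 := sub_add_I_ne_zero (by simp) y
  have hquot := (hf.sub (hasBoundaryValues_cauchyKernel c y)).div_sub (y := y)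
    (hdiff.sub (by fun_prop (disch := assumption))) (by simp [hc])
  have hae : (fun x : ℝ => ((V x - c * (I / (x - y + I))) / (x - y)).im) =ᵐ[volume]
      fun x => (V x).im / (x - y) - c * (1 + (x - y) ^ 2)⁻¹ := by
    filter_upwards [Measure.ae_ne volume y] with x hx using im_sub_cauchyKernel_div hx _
  have hpoisson : Integrable fun x : ℝ => c * (1 + (x - y) ^ 2)⁻¹ :=
    (integrable_inv_one_add_sq.comp_sub_right y).const_mul c
  have h0 := hquot.integral_im_eq_zero (by positivity)
    (fun z hz hR => norm_sub_cauchyKernel_div_le hdecay c y hz hR)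
    ((integrable_congr hae).2 (hint.sub hpoisson))
  rw [integral_congr_ae hae, integral_sub hint hpoisson, integral_const_mul,
    integral_sub_right_eq_self (fun x : ℝ => (1 + x ^ 2)⁻¹) y, integral_univ_inv_one_add_sq] at h0
  exact sub_eq_zero.1 h0

end HalfPlane

section SquareRoot

open Filter Topology Complex

/-- The principal square root; on the negative axis it is the boundary value from above. -/
def csqrt (z : ℂ) : ℂ := z ^ (2⁻¹ : ℂ)

lemma csqrt_sq (z : ℂ) : csqrt z ^ 2 = z := by
  simp [csqrt]

lemma norm_csqrt (z : ℂ) : ‖csqrt z‖ = √‖z‖ := by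
  rw [eq_comm, Real.sqrt_eq_iff_mul_self_eq (norm_nonneg _) (norm_nonneg _), ← norm_mul, ← sq,
    csqrt_sq]

lemma csqrt_ne_zero {z : ℂ} (hz : z ≠ 0) : csqrt z ≠ 0 := fun h =>
  hz (by rw [← csqrt_sq z, h, zero_pow two_ne_zero])

lemma differentiableAt_csqrt {z : ℂ} (hz : z ∈ slitPlane) : DifferentiableAt ℂ csqrt z :=
  differentiableAt_id.cpow_const hz

lemma csqrt_ofReal {x : ℝ} (hx : 0 ≤ x) : csqrt x = √x := by
  rw [csqrt, Real.sqrt_eq_rpow, ofReal_cpow hx]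
  norm_num

lemma csqrt_ofReal_neg {x : ℝ} (hx : x < 0) : csqrt x = I * √(-x) := by
  have hneg := csqrt_ofReal (neg_pos.2 hx).le
  rw [csqrt, ofReal_neg] at hneg
  rw [csqrt, ofReal_cpow_of_nonpos hx.le, hneg,
    show (Real.pi * I * 2⁻¹ : ℂ) = Real.pi / 2 * I by ring, exp_pi_div_two_mul_I, mul_comm]

lemma csqrt_div_csqrt {a b : ℝ} (h : 0 < a / b) : csqrt a / csqrt b = √(a / b) := by
  rcases div_pos_iff.1 h with ⟨ha, hb⟩ | ⟨ha, hb⟩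
  · rw [csqrt_ofReal ha.le, csqrt_ofReal hb.le, Real.sqrt_div ha.le, ofReal_div]
  · rw [csqrt_ofReal_neg ha, csqrt_ofReal_neg hb, mul_div_mul_left _ _ I_ne_zero,
      ← neg_div_neg_eq a, Real.sqrt_div (by linarith), ofReal_div]

lemma continuousWithinAt_csqrt {x : ℝ} (hx : x ≠ 0) :
    ContinuousWithinAt csqrt {z | 0 ≤ z.im} x := by
  rcases lt_or_gt_of_ne hx with hneg | hpos
  · have hlog : ContinuousWithinAt log {z | 0 ≤ z.im} (x : ℂ) :=
      continuousWithinAt_log_of_re_neg_of_im_zero (by simpa) (by simp)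
    have hexp := (hlog.mul continuousWithinAt_const).cexp (f := fun z => log z * 2⁻¹)
    refine hexp.congr_of_eventuallyEq ?_ (cpow_def_of_ne_zero (ofReal_ne_zero.2 hx) _)
    filter_upwards [mem_nhdsWithin_of_mem_nhds (isOpen_ne.mem_nhds (ofReal_ne_zero.2 hx))] with z hz
      using cpow_def_of_ne_zero hz _
  · exact (differentiableAt_csqrt (by simp [slitPlane, hpos])).continuousAt.continuousWithinAt

lemma im_eq_zero_of_sq_eq {z : ℂ} {r : ℝ} (hr : 0 < r) (h : z ^ 2 = r) : z.im = 0 := by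
  have hre : z.re * z.re - z.im * z.im = r := by simpa [sq] using congrArg re h
  have him : z.re * z.im + z.im * z.re = 0 := by simpa [sq] using congrArg im h
  by_contra hne
  have hz : z.re = 0 := (mul_eq_zero.1 (by linarith : z.re * z.im = 0)).resolve_right hne
  rw [hz] at hre
  nlinarith [mul_self_nonneg z.im]

end SquareRoot

section Stieltjes

open MeasureTheory Filter Topology Complex

variable {g : ℕ} {α β : Fin g → ℝ}

/-- The square root of `∏(z - α_j) / ((z² - 1) ∏(z - β_j))` in the closed upper half-plane. -/
def rootFun (α β : Fin g → ℝ) (z : ℂ) : ℂ :=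
  (∏ j, csqrt (z - α j)) / ∏ b ∈ singSet β, csqrt (z - b)

lemma Ordered.rootFun_ofReal_sq (ho : Ordered α β) (x : ℝ) :
    rootFun α β x ^ 2 = (((∏ j, (x - α j)) / ((x ^ 2 - 1) * ∏ j, (x - β j)) : ℝ) : ℂ) := by
  simp only [rootFun, div_pow, ← Finset.prod_pow, csqrt_sq]
  rw [ho.prod_singSet]
  push_cast
  congr 1
  ring

lemma differentiableAt_rootFun {z : ℂ} (hα : ∀ j, z - α j ∈ slitPlane)
    (hs : ∀ b ∈ singSet β, z - b ∈ slitPlane) : DifferentiableAt ℂ (rootFun α β) z := by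
  have hsub : ∀ a : ℝ, z - a ∈ slitPlane → DifferentiableAt ℂ (fun z => csqrt (z - a)) z :=
    fun a ha => (differentiableAt_csqrt ha).comp z (differentiableAt_id.sub_const _)
  exact (DifferentiableAt.fun_finsetProd fun j _ => hsub _ (hα j)).div
    (DifferentiableAt.fun_finsetProd fun b hb => hsub _ (hs b hb))
    (Finset.prod_ne_zero_iff.2 fun b hb => csqrt_ne_zero (slitPlane_ne_zero (hs b hb)))

lemma Ordered.differentiableAt_rootFun_of_one_lt (ho : Ordered α β) {x : ℝ} (hx : 1 < x) :
    DifferentiableAt ℂ (rootFun α β) x := by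
  have hslit : ∀ a : ℝ, a ≤ 1 → (x : ℂ) - a ∈ slitPlane := fun a ha => by
    rw [← ofReal_sub, ofReal_mem_slitPlane]
    linarith
  exact differentiableAt_rootFun (fun j => hslit _ (ho.α_lt_one j).le)
    fun b hb => hslit _ (abs_le.1 (ho.abs_le_one_of_mem_singSet hb)).2

lemma norm_rootFun (z : ℂ) :
    ‖rootFun α β z‖ = (∏ j, √‖z - α j‖) / ∏ b ∈ singSet β, √‖z - b‖ := by
  simp [rootFun, norm_csqrt]

lemma Ordered.norm_rootFun_le_div (ho : Ordered α β) {z : ℂ} (hz : 2 ≤ ‖z‖) :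
    ‖rootFun α β z‖ ≤ 2 * 2 ^ g / ‖z‖ := by
  have : 0 < √(‖z‖ / 2) := Real.sqrt_pos.2 (by linarith)
  have hnorm : ∀ a : ℝ, |a| ≤ 1 → ‖(a : ℂ)‖ ≤ ‖z‖ / 2 := fun a ha => by
    rw [norm_real, Real.norm_eq_abs]
    linarith
  have hα : ∀ j, |α j| ≤ 1 := fun j => abs_le.2 ⟨(ho.neg_one_lt_α j).le, (ho.α_lt_one j).le⟩
  rw [norm_rootFun]
  calc (∏ j, √‖z - α j‖) / ∏ b ∈ singSet β, √‖z - b‖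
      ≤ (∏ _j : Fin g, √(2 * ‖z‖)) / ∏ _b ∈ singSet β, √(‖z‖ / 2) := by
        gcongr with j _ b hb
        · linarith [norm_sub_le z (α j), hnorm _ (hα j)]
        · linarith [norm_sub_norm_le z b, hnorm b (ho.abs_le_one_of_mem_singSet hb)]
    _ = (√(2 * ‖z‖) / √(‖z‖ / 2)) ^ g / √(‖z‖ / 2) ^ 2 := by
        rw [ho.prod_singSet, Finset.prod_const, Finset.prod_const, Finset.card_univ,
          Fintype.card_fin, div_pow]
        field_simp
    _ = 2 * 2 ^ g / ‖z‖ := by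
        rw [← Real.sqrt_div (by positivity), show 2 * ‖z‖ / (‖z‖ / 2) = 2 ^ 2 by field_simp,
          Real.sqrt_sq (by norm_num), Real.sq_sqrt (by positivity)]
        field_simp

lemma norm_rootFun_le {x ε : ℝ} (hε : |ε| ≤ 1) (hs : x ∉ singSet β) :
    ‖rootFun α β (x + ε * I)‖ ≤ (∏ j, √(|x - α j| + 1)) * ∏ b ∈ singSet β, (√|x - b|)⁻¹ := by
  have hsub : ∀ a : ℝ, (x + ε * I : ℂ) - a = (x - a : ℝ) + ε * I := fun a => by push_cast; ring
  have hle : ∀ a : ℝ, ‖(x + ε * I : ℂ) - a‖ ≤ |x - a| + 1 := fun a => by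
    rw [hsub]
    exact norm_add_le_of_le (norm_real _).le (by rwa [norm_mul, norm_I, mul_one, norm_real])
  have hge : ∀ a : ℝ, |x - a| ≤ ‖(x + ε * I : ℂ) - a‖ := fun a => by
    simpa using abs_re_le_norm ((x + ε * I : ℂ) - a)
  have hpos : ∀ b ∈ singSet β, 0 < √|x - b| := fun b hb =>
    Real.sqrt_pos.2 (abs_pos.2 (sub_ne_zero.2 (ne_of_mem_of_not_mem hb hs).symm))
  rw [norm_rootFun, Finset.prod_inv_distrib, ← div_eq_mul_inv]
  gcongr with j _ b _
  · exact Finset.prod_pos hpos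
  · exact hle _
  · exact hge _

lemma continuousWithinAt_rootFun {x : ℝ} (hα : ∀ j, x ≠ α j) (hs : x ∉ singSet β) :
    ContinuousWithinAt (rootFun α β) {z | 0 ≤ z.im} x := by
  have hsub : ∀ a : ℝ, x ≠ a →
      ContinuousWithinAt (fun z : ℂ => csqrt (z - a)) {z | 0 ≤ z.im} x := fun a ha => by
    have hcsqrt := continuousWithinAt_csqrt (sub_ne_zero.2 ha)
    rw [ofReal_sub] at hcsqrt
    exact hcsqrt.comp (f := fun z : ℂ => z - a) (by fun_prop) fun z hz => by simpa using hz
  have hb : ∀ b ∈ singSet β, x ≠ b := fun b hb => (ne_of_mem_of_not_mem hb hs).symm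
  refine (tendsto_finsetProd _ fun j _ => hsub _ (hα j)).div
    (tendsto_finsetProd _ fun b hbs => hsub _ (hb b hbs))
    (Finset.prod_ne_zero_iff.2 fun b hbs => ?_)
  exact csqrt_ne_zero (sub_ne_zero.2 (by exact_mod_cast hb b hbs))

lemma hasBoundaryValues_rootFun : HasBoundaryValues (rootFun α β) fun x => rootFun α β x where
  differentiableOn z hz := by
    have hslit : ∀ a : ℝ, z - a ∈ slitPlane := fun a => Or.inr (by simpa using ne_of_gt hz)
    exact (differentiableAt_rootFun (fun _ => hslit _) fun _ _ => hslit _).differentiableWithinAt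
  tendsto := by
    filter_upwards [ae_ne_endpoints (α := α) (β := β)] with x ⟨hα, hs⟩
    exact (continuousWithinAt_rootFun hα hs).tendsto.comp (tendsto_ofReal_add_mul_I x)
  dominated := by
    have hcont : Continuous fun x : ℝ => ∏ j, √(|x - α j| + 1) :=
      continuous_finsetProd _ fun _ _ => by fun_prop
    refine ⟨_, fun a b => (intervalIntegrable_prod_inv_sqrt (singSet β) a b).continuousOn_mul
      hcont.continuousOn, ?_⟩
    filter_upwards [Ioo_mem_nhdsGT one_pos] with ε hε
    filter_upwards [ae_ne_endpoints (α := α) (β := β)] with x ⟨_, hs⟩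
      using norm_rootFun_le (abs_le.2 ⟨by linarith [hε.1], hε.2.le⟩) hs

lemma Ordered.rootFun_of_mem (ho : Ordered α β) {x : ℝ} (hα : ∀ j, x ≠ α j) (hs : x ∉ singSet β)
    (hx : x ∈ bandSet α β) : rootFun α β x = -I * (Real.pi * weight α β x : ℝ) := by
  obtain ⟨hne_one, -, hβ⟩ := notMem_singSet.1 hs
  obtain ⟨hx1, hx2⟩ := ho.bandSet_eq ▸ hx
  have hpos : ∀ j, 0 < (x - α j) / (x - β j) := fun j => ho.div_pos_of_le_or_ge hα hβ (hx2 j)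
  have hgaps : ∏ j, csqrt ((x : ℂ) - α j) / csqrt ((x : ℂ) - β j) =
      (∏ j, √((x - α j) / (x - β j)) : ℝ) := by
    rw [ofReal_prod]
    refine Finset.prod_congr rfl fun j _ => ?_
    rw [← ofReal_sub, ← ofReal_sub, csqrt_div_csqrt (hpos j)]
  have hends : csqrt ((x : ℂ) - (1 : ℝ)) * csqrt ((x : ℂ) - (-1 : ℝ)) = I * √(1 - x ^ 2) := by
    rw [← ofReal_sub, ← ofReal_sub, csqrt_ofReal_neg (by linarith [hx1.2.lt_of_ne hne_one]),
      csqrt_ofReal (by linarith [hx1.1]), show 1 - x ^ 2 = -(x - 1) * (x - -1) by ring,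
      Real.sqrt_mul (by linarith [hx1.2]), ofReal_mul, mul_assoc]
  have hweight : Real.pi * weight α β x = (∏ j, √((x - α j) / (x - β j))) / √(1 - x ^ 2) := by
    rw [weight, ← mul_assoc, mul_one_div_cancel Real.pi_ne_zero, one_mul, mul_comm (1 - x ^ 2),
      ← div_div, ← Finset.prod_div_distrib,
      Real.sqrt_div (Finset.prod_nonneg fun j _ => (hpos j).le),
      Real.sqrt_prod _ fun j _ => (hpos j).le]
  rw [rootFun, ho.prod_singSet, ← mul_assoc, hends, mul_comm, ← div_div,
    ← Finset.prod_div_distrib, hgaps, hweight, ofReal_div, ← div_div, div_right_comm, div_I]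
  ring

lemma Ordered.div_pos_of_notMem_bandSet (ho : Ordered α β) {x : ℝ} (hα : ∀ j, x ≠ α j)
    (hs : x ∉ singSet β) (hx : x ∉ bandSet α β) :
    0 < (∏ j, (x - α j)) / ((x ^ 2 - 1) * ∏ j, (x - β j)) := by
  obtain ⟨hne_one, hne_neg_one, hβ⟩ := notMem_singSet.1 hs
  rw [mul_comm, ← div_div, ← Finset.prod_div_distrib]
  by_cases hx1 : x ∈ Set.Icc (-1) 1
  · obtain ⟨k, hk⟩ : ∃ k, ¬(x ≤ α k ∨ β k ≤ x) := by
      by_contra! hall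
      exact hx (ho.bandSet_eq ▸ ⟨hx1, hall⟩)
    rw [not_or, not_le, not_le] at hk
    refine div_pos_of_neg_of_neg ?_
      (by nlinarith [hx1.1.lt_of_ne' hne_neg_one, hx1.2.lt_of_ne hne_one])
    rw [← Finset.mul_prod_erase _ _ (Finset.mem_univ k)]
    refine mul_neg_of_neg_of_pos (div_neg_of_pos_of_neg (by linarith) (by linarith))
      (Finset.prod_pos fun j hj => ho.div_pos_of_le_or_ge hα hβ ?_)
    rcases lt_or_gt_of_ne (Finset.ne_of_mem_erase hj) with hlt | hgt
    · exact Or.inr (by linarith [ho.β_lt_α hlt])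
    · exact Or.inl (by linarith [ho.β_lt_α hgt])
  · rw [Set.mem_Icc, not_and_or, not_le, not_le] at hx1
    refine div_pos (Finset.prod_pos fun j _ => ho.div_pos_of_le_or_ge hα hβ ?_) ?_
    · exact hx1.imp (fun h => by linarith [ho.neg_one_lt_α j]) fun h => by linarith [ho.β_lt_one j]
    · rcases hx1 with h | h <;> nlinarith

lemma Ordered.rootFun_im_of_notMem (ho : Ordered α β) {x : ℝ} (hα : ∀ j, x ≠ α j)
    (hs : x ∉ singSet β) (hx : x ∉ bandSet α β) : (rootFun α β x).im = 0 :=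
  im_eq_zero_of_sq_eq (ho.div_pos_of_notMem_bandSet hα hs hx) (ho.rootFun_ofReal_sq x)

lemma Ordered.rootFun_im_of_one_lt (ho : Ordered α β) {x : ℝ} (hx : 1 < x) :
    (rootFun α β x).im = 0 := by
  refine ho.rootFun_im_of_notMem (fun j => ((ho.α_lt_one j).trans hx).ne') (fun hs => ?_)
    fun hE => (ho.bandSet_subset hE).2.not_gt hx
  exact (abs_le.1 (ho.abs_le_one_of_mem_singSet hs)).2.not_gt hx

/-- The boundary values of `rootFun` have imaginary part `-π w` on `E` and `0` off `E`, so
`rootFun` is the Stieltjes transform of `w`. -/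
theorem Ordered.rootFun_eq_psi_zero (ho : Ordered α β) {y : ℝ} (hy : 1 < y) :
    rootFun α β y = psi α β 0 y := by
  let u : ℝ → ℝ := (bandSet α β).indicator fun t =>
    Real.pi * ((P α β 0).eval t / (y - t) * weight α β t)
  have hu : (fun x : ℝ => (rootFun α β x).im / (x - y)) =ᵐ[volume] u := by
    filter_upwards [ae_ne_endpoints (α := α) (β := β)] with x ⟨hα, hs⟩
    by_cases hx : x ∈ bandSet α β
    · simp only [u, Set.indicator_of_mem hx, ho.rootFun_of_mem hα hs hx, neg_mul, neg_im, I_mul_im,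
        ofReal_re, P_zero, eval_one]
      rw [← neg_sub y x, neg_div_neg_eq]
      ring
    · rw [ho.rootFun_im_of_notMem hα hs hx, zero_div]
      exact (Set.indicator_of_notMem hx _).symm
  have hint : Integrable u := by
    rw [integrable_indicator_iff measurableSet_bandSet]
    exact (ho.integrableOn_div _ hy).const_mul _
  have hre : rootFun α β y = ((rootFun α β y).re : ℂ) :=
    Complex.ext rfl (ho.rootFun_im_of_one_lt hy)
  have hint_eq := hasBoundaryValues_rootFun.integral_im_div_sub (by positivity)
    (fun z _ hz => ho.norm_rootFun_le_div hz) (ho.differentiableAt_rootFun_of_one_lt hy) hre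
    ((integrable_congr hu).2 hint)
  rw [integral_congr_ae hu, integral_indicator measurableSet_bandSet, integral_const_mul,
    mul_comm] at hint_eq
  rw [hre, ← mul_right_cancel₀ Real.pi_ne_zero hint_eq, psi]

lemma Ordered.psi_zero_sq (ho : Ordered α β) {x : ℝ} (hx : 1 < x) :
    psi α β 0 x ^ 2 * ((x ^ 2 - 1) * ∏ j, (x - β j)) = ∏ j, (x - α j) := by
  have hsq := ho.rootFun_ofReal_sq x
  rw [ho.rootFun_eq_psi_zero hx] at hsq
  have hne : (x ^ 2 - 1) * ∏ j, (x - β j) ≠ 0 := mul_ne_zero (by nlinarith)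
    (Finset.prod_ne_zero_iff.2 fun j _ => by linarith [ho.β_lt_one j])
  exact (eq_div_iff hne).1 (by exact_mod_cast hsq)

end Stieltjes

section Periodicity

open Filter Topology

variable {g : ℕ} {α β : Fin g → ℝ} {K : ℕ}

lemma abs_psi_le_of_le (ho : Ordered α β) {m n : ℕ} (hmn : m ≤ n) {x : ℝ} (hx : 1 < x) :
    |psi α β n x| ≤ √(h α β m) * ((1 + h α β 0) / 2) / (x - 1) / x ^ m := by
  have : 0 < x - 1 := sub_pos.2 hx
  have hh0 := h_pos ho 0
  refine (abs_psi_le ho n hx).trans ?_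
  gcongr
  · exact h_antitone ho hmn
  · exact hx.le

lemma abs_psi_mul_psi_le (ho : Ordered α β) {n m m' : ℕ} (hm : n ≤ m) (hm' : n ≤ m') {x : ℝ}
    (hx : 1 < x) : |psi α β m x * psi α β m' x| ≤
      h α β n * (((1 + h α β 0) / 2 / (x - 1)) ^ 2 * (x⁻¹ ^ 2) ^ n) := by
  rw [abs_mul]
  calc |psi α β m x| * |psi α β m' x|
      ≤ (√(h α β n) * ((1 + h α β 0) / 2) / (x - 1) / x ^ n) ^ 2 := by
        rw [sq]
        exact mul_le_mul (abs_psi_le_of_le ho hm hx) (abs_psi_le_of_le ho hm' hx) (abs_nonneg _)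
          ((abs_nonneg _).trans (abs_psi_le_of_le ho hm hx))
    _ = √(h α β n) ^ 2 * (((1 + h α β 0) / 2 / (x - 1)) ^ 2 * (x⁻¹ ^ 2) ^ n) := by
        rw [div_eq_mul_inv _ (x ^ n), ← inv_pow]; ring
    _ = _ := by rw [Real.sq_sqrt (h_pos ho n).le]

/-- The Casoratian of the shifted and the original sequence is `W n = (h (n + 1) / h 1) * W 0`
while `|W n| ≤ C * h (n + 1) / x ^ (2 * (n + 1))`, which forces `W 0 = 0`. -/
lemma HasPeriod.casoratian_psi_eq_zero (hper : HasPeriod α β K) (ho : Ordered α β) {x : ℝ}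
    (hx : 1 < x) :
    psi α β (K + 1) x * psi α β 2 x - psi α β (K + 2) x * psi α β 1 x = 0 := by
  have hrec := isThreeTerm_psi ho hx
  set W : ℕ → ℝ := fun n => psi α β (n + 1 + K) x * psi α β (n + 1 + 1) x -
    psi α β (n + 1 + 1 + K) x * psi α β (n + 1) x with hW
  have hW_eq (n : ℕ) : h α β 1 * W n = h α β (n + 1) * W 0 := by
    induction n with
    | zero => rw [zero_add]
    | succ n ih =>
      have hstep : W (n + 1) = recA α β (n + 2) * W n :=
        (hrec.add_period hper.1 hper.2).casoratian_succ hrec.succ n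
      rw [hstep, h_succ ho (n + 1)]
      linear_combination recA α β (n + 2) * ih
  set c := ((1 + h α β 0) / 2 / (x - 1)) ^ 2
  have hbound (n : ℕ) : |W n| ≤ h α β (n + 1) * (2 * c * (x⁻¹ ^ 2) ^ (n + 1)) := by
    refine (abs_sub _ _).trans ((add_le_add
      (abs_psi_mul_psi_le ho (n := n + 1) (by omega) (by omega) hx)
      (abs_psi_mul_psi_le ho (n := n + 1) (by omega) le_rfl hx)).trans_eq ?_)
    ring
  have hlim : Tendsto (fun n : ℕ => 2 * c * h α β 1 * (x⁻¹ ^ 2) ^ (n + 1)) atTop (𝓝 0) := by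
    have hx1 : x⁻¹ ^ 2 < 1 := pow_lt_one₀ (by positivity) (inv_lt_one_of_one_lt₀ hx) two_ne_zero
    simpa using ((tendsto_pow_atTop_nhds_zero_of_lt_one (by positivity) hx1).comp
      (tendsto_add_atTop_nat 1)).const_mul (2 * c * h α β 1)
  suffices hW_zero : W 0 = 0 by
    simpa only [hW, zero_add, add_comm 1 K, add_comm 2 K, one_add_one_eq_two] using hW_zero
  refine abs_nonpos_iff.1 (ge_of_tendsto' hlim fun n => ?_)
  refine le_of_mul_le_mul_left ?_ (h_pos ho (n + 1))
  calc h α β (n + 1) * |W 0| = h α β 1 * |W n| := by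
        rw [← abs_of_pos (h_pos ho (n + 1)), ← abs_mul, ← hW_eq, abs_mul,
          abs_of_pos (h_pos ho 1)]
    _ ≤ h α β 1 * (h α β (n + 1) * (2 * c * (x⁻¹ ^ 2) ^ (n + 1))) :=
        mul_le_mul_of_nonneg_left (hbound n) (h_pos ho 1).le
    _ = _ := by ring

lemma HasPeriod.psi_mul_psi (hper : HasPeriod α β K) (ho : Ordered α β) {x : ℝ} (hx : 1 < x) :
    recA α β (K + 1) * (psi α β K x * psi α β 1 x) =
      recA α β 1 * (psi α β 0 x * psi α β (K + 1) x) := by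
  have hrec_zero := isThreeTerm_psi ho hx 0
  have hrec_K := isThreeTerm_psi ho hx K
  rw [add_comm K 2, hper.1 2 one_le_two, add_comm 2 K] at hrec_K
  rw [zero_add, zero_add] at hrec_zero
  linear_combination
    hper.casoratian_psi_eq_zero ho hx - psi α β (K + 1) x * hrec_zero + psi α β 1 x * hrec_K

end Periodicity

section Pell

variable {g : ℕ} {α β : Fin g → ℝ} {K : ℕ}

/-- The polynomial `∏ (X - α_j)`. Together with `denPoly` it describes the square of the Cauchy
transform of the weight: `ψ₀² = numPoly / denPoly`. -/
def numPoly (α : Fin g → ℝ) : ℝ[X] := ∏ j, (X - C (α j))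

/-- The polynomial `(X² - 1) ∏ (X - β_j)`, see `numPoly`. -/
def denPoly (β : Fin g → ℝ) : ℝ[X] := (X ^ 2 - 1) * ∏ j, (X - C (β j))

@[simp] lemma eval_numPoly (x : ℝ) : (numPoly α).eval x = ∏ j, (x - α j) := by
  simp [numPoly, eval_prod]

@[simp] lemma eval_denPoly (x : ℝ) : (denPoly β).eval x = (x ^ 2 - 1) * ∏ j, (x - β j) := by
  simp [denPoly, eval_prod]

lemma monic_numPoly : (numPoly α).Monic := monic_prod_X_sub_C _ _

lemma natDegree_numPoly : (numPoly α).natDegree = g := by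
  simp [numPoly]

lemma monic_denPoly : (denPoly β).Monic := by
  have hsq : (X ^ 2 - 1 : ℝ[X]).Monic := by simpa using monic_X_pow_sub_C (1 : ℝ) two_ne_zero
  exact hsq.mul (monic_prod_X_sub_C _ _)

lemma natDegree_denPoly : (denPoly β).natDegree = g + 2 := by
  have hsq : (X ^ 2 - 1 : ℝ[X]).natDegree = 2 := by
    simpa using natDegree_X_pow_sub_C (n := 2) (r := (1 : ℝ))
  have hne : (X ^ 2 - 1 : ℝ[X]) ≠ 0 := by rintro h; simp [h] at hsq
  rw [denPoly, natDegree_mul hne (monic_prod_X_sub_C _ _).ne_zero, hsq]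
  simp [add_comm]

lemma StrictlyOrdered.isCoprime (ho : StrictlyOrdered α β) :
    IsCoprime (numPoly α) (denPoly β) := by
  refine IsCoprime.prod_left fun j _ => ?_
  rw [(irreducible_X_sub_C (α j)).coprime_iff_not_dvd, dvd_iff_isRoot, IsRoot, eval_denPoly]
  refine mul_ne_zero ?_ (Finset.prod_ne_zero_iff.2 fun i _ => ?_)
  · nlinarith [ho.ordered.neg_one_lt_α j, ho.ordered.α_lt_one j]
  · rcases lt_trichotomy i j with hij | rfl | hij
    · exact (sub_pos.2 (ho.ordered.β_lt_α hij)).ne'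
    · exact (sub_neg.2 (ho.2 i)).ne
    · exact (sub_neg.2 ((ho.2 j).trans ((ho.ordered.β_lt_α hij).trans (ho.2 i)))).ne

lemma Ordered.rootMultiplicity_one (ho : Ordered α β) :
    rootMultiplicity 1 (numPoly α * denPoly β) = 1 := by
  set D : ℝ[X] := numPoly α * ((X + 1) * ∏ j, (X - C (β j)))
  have hD : numPoly α * denPoly β = D * (X - C 1) ^ 1 := by rw [denPoly, C_1]; ring
  have hD_one : ¬ D.IsRoot 1 := by
    simp only [IsRoot, D, eval_mul, eval_numPoly, eval_add, eval_X, eval_one, eval_prod, eval_sub,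
      eval_C]
    exact mul_ne_zero (Finset.prod_ne_zero_iff.2 fun j _ => (sub_pos.2 (ho.α_lt_one j)).ne')
      (mul_ne_zero (by norm_num)
        (Finset.prod_ne_zero_iff.2 fun j _ => (sub_pos.2 (ho.β_lt_one j)).ne'))
  have hD_ne : D ≠ 0 := by rintro h0; exact hD_one (by rw [h0]; exact eval_zero)
  rw [hD, rootMultiplicity_mul_X_sub_C_pow hD_ne, rootMultiplicity_eq_zero hD_one]

/-- `numPoly * denPoly` is not a square: its multiplicity at `1` is odd. -/
lemma Ordered.eq_zero_of_sq_eq (ho : Ordered α β) {Y B : ℝ[X]}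
    (hYB : Y ^ 2 = B ^ 2 * (numPoly α * denPoly β)) : B = 0 := by
  by_contra hB
  have hB_sq : B ^ 2 * (numPoly α * denPoly β) ≠ 0 :=
    mul_ne_zero (pow_ne_zero 2 hB) (mul_ne_zero monic_numPoly.ne_zero monic_denPoly.ne_zero)
  have hY_sq : Y * Y ≠ 0 := by rwa [← sq, hYB]
  have hmult := congrArg (rootMultiplicity 1) hYB
  rw [rootMultiplicity_mul hB_sq, ho.rootMultiplicity_one, sq, sq, rootMultiplicity_mul hY_sq,
    rootMultiplicity_mul (mul_ne_zero hB hB)] at hmult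
  omega

lemma Ordered.denPoly_mul_psi_zero_sq (ho : Ordered α β) {x : ℝ} (hx : 1 < x) :
    (denPoly β).eval x * psi α β 0 x ^ 2 = (numPoly α).eval x := by
  rw [eval_numPoly, eval_denPoly, ← ho.psi_zero_sq hx, mul_comm]

/-- `ψ₀` is not a rational function. -/
lemma Ordered.eq_zero_of_eval_eq_mul_psi (ho : Ordered α β) {Y B : ℝ[X]}
    (hYB : ∀ x : ℝ, 1 < x → Y.eval x = B.eval x * ((denPoly β).eval x * psi α β 0 x)) :
    B = 0 ∧ Y = 0 := by
  have hsq : Y ^ 2 = B ^ 2 * (numPoly α * denPoly β) := by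
    refine eq_of_infinite_eval_eq _ _ ((Set.Ioi_infinite (1 : ℝ)).mono fun x hx => ?_)
    simp only [Set.mem_ofPred_eq, eval_pow, eval_mul]
    rw [hYB x hx, ← ho.denPoly_mul_psi_zero_sq hx]
    ring
  have hB := ho.eq_zero_of_sq_eq hsq
  exact ⟨hB, pow_eq_zero_iff two_ne_zero |>.1 (by rw [hsq, hB]; ring)⟩

/-- Inserting `ψ_n = P_n ψ₀ - Q_n` into the relation `HasPeriod.psi_mul_psi` gives a quadratic
equation for `ψ₀`. Since `ψ₀²` is rational and `ψ₀` is not, its coefficients vanish. -/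
lemma HasPeriod.relations (hper : HasPeriod α β K) (ho : Ordered α β) :
    C (recA α β (K + 1)) * (C (h α β 0) * P α β K + secondPoly α β K * P α β 1) =
        C (recA α β 1) * secondPoly α β (K + 1) ∧
      (C (recA α β 1) * P α β (K + 1) - C (recA α β (K + 1)) * (P α β K * P α β 1)) * numPoly α =
        C (recA α β (K + 1)) * (C (h α β 0) * secondPoly α β K * denPoly β) := by
  set a := recA α β 1
  set a' := recA α β (K + 1)
  set B := C a' * (C (h α β 0) * P α β K + secondPoly α β K * P α β 1) -
    C a * secondPoly α β (K + 1) with hB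
  set Y := C a' * (C (h α β 0) * secondPoly α β K * denPoly β) -
    (C a * P α β (K + 1) - C a' * (P α β K * P α β 1)) * numPoly α with hY
  have hYB (x : ℝ) (hx : 1 < x) :
      Y.eval x = B.eval x * ((denPoly β).eval x * psi α β 0 x) := by
    have hpsi := hper.psi_mul_psi ho hx
    rw [psi_eq ho K hx, psi_eq ho 1 hx, psi_eq ho (K + 1) hx, secondPoly_one, eval_C] at hpsi
    simp only [hY, hB, eval_add, eval_sub, eval_mul, eval_C,
      ← ho.denPoly_mul_psi_zero_sq hx]
    linear_combination (denPoly β).eval x * hpsi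
  obtain ⟨hB_zero, hY_zero⟩ := ho.eq_zero_of_eval_eq_mul_psi hYB
  exact ⟨sub_eq_zero.1 hB_zero, (sub_eq_zero.1 hY_zero).symm⟩

lemma natDegree_secondPoly_le (n : ℕ) : (secondPoly α β n).natDegree ≤ n - 1 := by
  induction n using Nat.twoStepInduction with
  | zero => simp
  | one => simp
  | more n ih ih_succ =>
    rw [isThreeTerm_secondPoly]
    have hX := natDegree_mul_le_of_le (natDegree_X_sub_C_le (recB α β (n + 2))) ih_succ
    have hC := natDegree_C_mul_le (recA α β (n + 1)) (secondPoly α β n)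
    exact (natDegree_sub_le_of_le (hX.trans (by omega : _ ≤ n + 1))
      (hC.trans (by omega : _ ≤ n + 1))).trans (max_self _).le

lemma coeff_secondPoly_succ (n : ℕ) : (secondPoly α β (n + 1)).coeff n = h α β 0 := by
  induction n with
  | zero => simp
  | succ n ih =>
    have hcoeff {m : ℕ} (hm : m - 1 < n + 1) : (secondPoly α β m).coeff (n + 1) = 0 :=
      coeff_eq_zero_of_natDegree_lt ((natDegree_secondPoly_le m).trans_lt hm)
    rw [isThreeTerm_secondPoly, coeff_sub, sub_mul, coeff_sub, coeff_X_mul, ih, coeff_C_mul,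
      coeff_C_mul, hcoeff (by omega), hcoeff (by omega)]
    ring

lemma natDegree_secondPoly_succ (ho : Ordered α β) (n : ℕ) :
    (secondPoly α β (n + 1)).natDegree = n :=
  natDegree_eq_of_le_of_coeff_ne_zero (natDegree_secondPoly_le _)
    (coeff_secondPoly_succ n ▸ (h_pos ho 0).ne')

lemma leadingCoeff_secondPoly_succ (ho : Ordered α β) (n : ℕ) :
    (secondPoly α β (n + 1)).leadingCoeff = h α β 0 := by
  rw [leadingCoeff, natDegree_secondPoly_succ ho, coeff_secondPoly_succ]

lemma coeff_P_self (n : ℕ) : (P α β n).coeff n = 1 := by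
  simpa using (monic_P (α := α) (β := β) n).coeff_natDegree

lemma HasPeriod.recA_one (hper : HasPeriod α β (K + 1)) (ho : Ordered α β) :
    recA α β 1 = 2 * recA α β (K + 1 + 1) := by
  have hlead := congrArg (coeff · (K + 1)) (hper.relations ho).1
  simp only [coeff_C_mul, coeff_add, coeff_P_self, coeff_secondPoly_succ] at hlead
  rw [coeff_mul_add_eq_of_natDegree_le (natDegree_secondPoly_succ ho K).le (natDegree_P 1).le,
    coeff_secondPoly_succ, coeff_P_self] at hlead
  exact mul_right_cancel₀ (h_pos ho 0).ne' (by linear_combination -hlead)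

lemma HasPeriod.two_mul_secondPoly (hper : HasPeriod α β (K + 1)) (ho : Ordered α β) :
    2 * secondPoly α β (K + 1 + 1) =
      C (h α β 0) * P α β (K + 1) + secondPoly α β (K + 1) * P α β 1 := by
  refine mul_left_cancel₀ (C_ne_zero.2 (recA_pos ho (K + 1 + 1)).ne') ?_
  rw [(hper.relations ho).1, hper.recA_one ho, C_mul, C_ofNat]
  ring

lemma HasPeriod.two_mul_P_sub_mul_numPoly (hper : HasPeriod α β (K + 1)) (ho : Ordered α β) :
    (2 * P α β (K + 1 + 1) - P α β (K + 1) * P α β 1) * numPoly α =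
      C (h α β 0) * secondPoly α β (K + 1) * denPoly β := by
  refine mul_left_cancel₀ (C_ne_zero.2 (recA_pos ho (K + 1 + 1)).ne') ?_
  rw [← (hper.relations ho).2, hper.recA_one ho, C_mul, C_ofNat]
  ring

/-- The zeros of `S` will be the closed gaps. -/
lemma HasPeriod.exists_factor (hper : HasPeriod α β (K + 1)) (ho : StrictlyOrdered α β) :
    ∃ S : ℝ[X], S.Monic ∧ g + S.natDegree = K ∧ h α β 0 = 1 ∧
      secondPoly α β (K + 1) = numPoly α * S ∧
        2 * P α β (K + 1 + 1) = P α β (K + 1) * P α β 1 + denPoly β * S := by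
  have hh0 := h_pos ho.ordered 0
  have hmul := hper.two_mul_P_sub_mul_numPoly ho.ordered
  obtain ⟨S, hS⟩ : numPoly α ∣ secondPoly α β (K + 1) := by
    refine (isUnit_C.2 hh0.ne'.isUnit).dvd_mul_left.1 ?_
    exact ho.isCoprime.dvd_of_dvd_mul_right (hmul ▸ dvd_mul_left _ _)
  have hlead : S.leadingCoeff = h α β 0 := by
    rw [← leadingCoeff_secondPoly_succ ho.ordered K, hS, leadingCoeff_monic_mul monic_numPoly]
  have hdeg : g + S.natDegree = K := by
    rw [← natDegree_secondPoly_succ ho.ordered K, hS, monic_numPoly.natDegree_mul' ?_,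
      natDegree_numPoly]
    exact leadingCoeff_ne_zero.1 (hlead ▸ hh0.ne')
  have hP : 2 * P α β (K + 1 + 1) - P α β (K + 1) * P α β 1 = C (h α β 0) * (denPoly β * S) :=
    mul_right_cancel₀ (monic_numPoly (α := α)).ne_zero (by rw [hmul, hS]; ring)
  have hh0_sq : h α β 0 * h α β 0 = 1 := by
    have hcoeff := congrArg (coeff · (K + 1 + 1)) hP
    have hPP := coeff_mul_add_eq_of_natDegree_le (natDegree_P (α := α) (β := β) (K + 1)).le
      (natDegree_P (α := α) (β := β) 1).le
    have hDS := coeff_mul_degree_add_degree (denPoly β) S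
    rw [natDegree_denPoly, monic_denPoly.leadingCoeff, hlead,
      show g + 2 + S.natDegree = K + 1 + 1 by omega, one_mul] at hDS
    simp only [coeff_sub, coeff_ofNat_mul, coeff_C_mul, hPP, hDS, coeff_P_self] at hcoeff
    linear_combination -hcoeff
  have hh0_one : h α β 0 = 1 := by nlinarith
  refine ⟨S, hlead.trans hh0_one, hdeg, hh0_one, hS, ?_⟩
  rw [hh0_one, C_1, one_mul] at hP
  linear_combination hP

lemma Δ_pos (ho : Ordered α β) (K : ℕ) : 0 < Δ α β K :=
  Real.sqrt_pos.2 (mul_pos two_pos (h_pos ho K))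

/-- The algebraic form of periodicity: `P_K` and a polynomial `S`, whose zeros will be the closed
gaps, solve a Pell equation and describe the shift of the recurrence by a period. -/
structure IsPellFactor (α β : Fin g → ℝ) (K : ℕ) (S : ℝ[X]) : Prop where
  monic : S.Monic
  natDegree_add : g + S.natDegree + 1 = K
  secondPoly_eq : secondPoly α β K = numPoly α * S
  pell : P α β K ^ 2 = C (Δ α β K ^ 2) + denPoly β * numPoly α * S ^ 2
  two_mul_P_add (n : ℕ) : 2 * P α β (n + 1 + K) =
    P α β K * P α β (n + 1) + denPoly β * S * secondPoly α β (n + 1)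
  two_mul_secondPoly_add (n : ℕ) : 2 * secondPoly α β (n + 1 + K) =
    secondPoly α β K * P α β (n + 1) + P α β K * secondPoly α β (n + 1)

theorem HasPeriod.exists_isPellFactor (hper : HasPeriod α β K) (ho : StrictlyOrdered α β)
    (hK : 1 ≤ K) : ∃ S, IsPellFactor α β K S := by
  obtain ⟨K, rfl⟩ := Nat.exists_eq_add_of_le' hK
  obtain ⟨S, hS, hdeg, hh0, hQ, hP_succ⟩ := hper.exists_factor ho
  have hQ_succ := hper.two_mul_secondPoly ho.ordered
  rw [hh0, C_1, one_mul] at hQ_succ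
  have hP := isThreeTerm_P ho.ordered
  have hQ' := isThreeTerm_secondPoly (α := α) (β := β)
  have hshift {u v : ℕ → ℝ[X]}
      (hu : IsThreeTerm (fun n => C (recA α β n)) (fun n => C (recB α β n)) X u)
      (hv : IsThreeTerm (fun n => C (recA α β n)) (fun n => C (recB α β n)) X v)
      (h0 : u (K + 1) = v 0) (h1 : 2 * u (K + 1 + 1) = v 1) (n : ℕ) :
      2 * u (n + 1 + (K + 1)) = v (n + 1) :=
    hu.two_mul_add_period hv (fun n hn => congrArg C (hper.1 n hn))
      (fun n hn => congrArg C (hper.2 n hn)) (by rw [hper.recA_one ho.ordered, C_mul, C_ofNat])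
      h0 h1 n
  refine ⟨S, hS, by omega, hQ, ?_, ?_, ?_⟩
  · have hdet := P_mul_secondPoly_sub ho.ordered (K + 1)
    have hΔ : C (Δ α β (K + 1) ^ 2) = 2 * C (h α β (K + 1)) := by
      rw [Δ, Real.sq_sqrt (mul_pos two_pos (h_pos ho.ordered _)).le, C_mul, C_ofNat]
    rw [hΔ, ← hdet]
    linear_combination -P α β (K + 1) * hQ_succ + secondPoly α β (K + 1) * hP_succ +
      denPoly β * S * hQ
  · exact hshift hP ((hP.const_mul _).add (hQ'.const_mul _)) (by simp)
      (by rw [hP_succ, secondPoly_one, hh0, C_1, mul_one])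
  · exact hshift hQ' ((hP.const_mul _).add (hQ'.const_mul _)) (by simp)
      (by rw [hQ_succ, secondPoly_one, hh0, C_1, mul_one, add_comm])

/-- The polynomial `P_K / Δ_K`. -/
def normPoly (α β : Fin g → ℝ) (K : ℕ) : ℝ[X] := C (Δ α β K)⁻¹ * P α β K

lemma P_eq_normPoly (ho : Ordered α β) (K : ℕ) :
    P α β K = C (Δ α β K) * normPoly α β K := by
  rw [normPoly, ← mul_assoc, ← C_mul, mul_inv_cancel₀ (Δ_pos ho K).ne', C_1, one_mul]

variable {S : ℝ[X]}

lemma IsPellFactor.normPoly_sq (hS : IsPellFactor α β K S) (ho : Ordered α β) :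
    C (Δ α β K ^ 2) * (normPoly α β K ^ 2 - 1) = denPoly β * numPoly α * S ^ 2 := by
  have hpell := hS.pell
  rw [P_eq_normPoly ho, mul_pow, ← C_pow] at hpell
  linear_combination hpell

lemma IsPellFactor.two_pow_mul (hS : IsPellFactor α β K S) (ho : Ordered α β) (n : ℕ) :
    2 ^ n * P α β ((n + 1) * K) =
        C (Δ α β K ^ (n + 1)) * (Chebyshev.T ℝ (n + 1)).comp (normPoly α β K) ∧
      2 ^ n * secondPoly α β ((n + 1) * K) =
        C (Δ α β K ^ n) * secondPoly α β K * (Chebyshev.U ℝ n).comp (normPoly α β K) := by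
  set p := normPoly α β K
  have hP : P α β K = C (Δ α β K) * p := P_eq_normPoly ho K
  induction n with
  | zero => simp [hP]
  | succ n ih =>
    obtain ⟨m, hm⟩ : ∃ m, (n + 1) * K = m + 1 :=
      Nat.exists_eq_add_one.2 (Nat.mul_pos n.succ_pos (by have := hS.natDegree_add; omega))
    have hadd_P := hS.two_mul_P_add m
    have hadd_Q := hS.two_mul_secondPoly_add m
    rw [← hm, ← Nat.succ_mul, hP] at hadd_P hadd_Q
    have hT : (Chebyshev.T ℝ ((n : ℤ) + 1 + 1)).comp p =
        p * (Chebyshev.T ℝ ((n : ℤ) + 1)).comp p - (1 - p ^ 2) * (Chebyshev.U ℝ n).comp p := by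
      rw [add_assoc, one_add_one_eq_two, Chebyshev.T_eq_X_mul_T_sub_pol_U]; simp
    have hU : (Chebyshev.U ℝ ((n : ℤ) + 1)).comp p =
        p * (Chebyshev.U ℝ n).comp p + (Chebyshev.T ℝ ((n : ℤ) + 1)).comp p := by
      rw [Chebyshev.U_eq_X_mul_U_add_T]; simp
    have hpell := hS.normPoly_sq ho
    push_cast
    rw [hT, hU]
    simp only [C_pow] at ih hpell ⊢
    constructor
    · linear_combination 2 ^ n * hadd_P + C (Δ α β K) * p * ih.1 + denPoly β * S * ih.2 -
        C (Δ α β K) ^ n * (Chebyshev.U ℝ n).comp p * hpell +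
        denPoly β * S * C (Δ α β K) ^ n * (Chebyshev.U ℝ n).comp p * hS.secondPoly_eq
    · linear_combination 2 ^ n * hadd_Q + secondPoly α β K * ih.1 + C (Δ α β K) * p * ih.2

lemma IsPellFactor.P_mul (hS : IsPellFactor α β K S) (ho : Ordered α β) (n : ℕ) :
    P α β (n * K) = C (Δ α β K ^ n) * (monicT n).comp (normPoly α β K) := by
  cases n with
  | zero => simp [monicT]
  | succ n =>
    have hinv : (2 : ℝ[X]) ^ n * C ((2 : ℝ) ^ n)⁻¹ = 1 := by
      rw [← C_ofNat, ← C_pow, ← C_mul, mul_inv_cancel₀ (pow_ne_zero n two_ne_zero), C_1]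
    refine mul_left_cancel₀ (pow_ne_zero n two_ne_zero : (2 : ℝ[X]) ^ n ≠ 0) ?_
    rw [(hS.two_pow_mul ho n).1, monicT, mul_comp, C_comp, Nat.add_sub_cancel, C_pow]
    push_cast
    linear_combination -C (Δ α β K) ^ (n + 1) *
      (Chebyshev.T ℝ ((n : ℤ) + 1)).comp (normPoly α β K) * hinv

end Pell

section Gaps

open Set

variable {g k : ℕ} {α β : Fin g → ℝ} {p S : ℝ[X]}

/-- The Pell equation `c (p² - 1) = (x² - 1) ∏ (x - α_j)(x - β_j) S²` with some `c > 0`, which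
says that `E` is the inverse image of `[-1, 1]` under `p`. -/
structure IsPellSolution (α β : Fin g → ℝ) (p S : ℝ[X]) : Prop where
  factor_ne_zero : S ≠ 0
  pell : ∃ c : ℝ, 0 < c ∧ C c * (p ^ 2 - 1) = denPoly β * numPoly α * S ^ 2

lemma IsPellFactor.isPellSolution {K : ℕ} (hS : IsPellFactor α β K S) (ho : Ordered α β) :
    IsPellSolution α β (normPoly α β K) S :=
  ⟨hS.monic.ne_zero, _, pow_pos (Δ_pos ho K) 2, hS.normPoly_sq ho⟩

lemma hasSimpleZerosIn_normPoly (ho : Ordered α β) (K : ℕ) :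
    HasSimpleZerosIn (normPoly α β K) univ :=
  (hasSimpleZerosIn_P ho K).const_mul (inv_ne_zero (Δ_pos ho K).ne')

lemma natDegree_normPoly (ho : Ordered α β) (K : ℕ) : (normPoly α β K).natDegree = K := by
  rw [normPoly, natDegree_C_mul (inv_ne_zero (Δ_pos ho K).ne'), natDegree_P]

lemma eval_normPoly (K : ℕ) (x : ℝ) :
    (normPoly α β K).eval x = (P α β K).eval x / Δ α β K := by
  rw [normPoly, eval_mul, eval_C, inv_mul_eq_div]

lemma eval_denPoly_mul_eval_numPoly (x : ℝ) :
    (denPoly β).eval x * (numPoly α).eval x = (x ^ 2 - 1) * ∏ j, (x - α j) * (x - β j) := by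
  rw [eval_denPoly, eval_numPoly, Finset.prod_mul_distrib]
  ring

lemma Ordered.mul_nonneg_of_le_or_ge (ho : Ordered α β) {x : ℝ} {j : Fin g}
    (hx : x ≤ α j ∨ β j ≤ x) : 0 ≤ (x - α j) * (x - β j) := by
  have := ho.2 j
  rcases hx with hx | hx <;> nlinarith

lemma Ordered.eval_nonneg_of_mem_gap (ho : Ordered α β) {x : ℝ} {j : Fin g}
    (hx : x ∈ Icc (α j) (β j)) : 0 ≤ (denPoly β).eval x * (numPoly α).eval x := by
  rw [eval_denPoly_mul_eval_numPoly, ← Finset.mul_prod_erase _ _ (Finset.mem_univ j), ← mul_assoc]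
  refine mul_nonneg (mul_nonneg_of_nonpos_of_nonpos ?_ ?_) (Finset.prod_nonneg fun i hi =>
    ho.mul_nonneg_of_le_or_ge ?_)
  · nlinarith [hx.1, hx.2, ho.neg_one_lt_α j, ho.β_lt_one j]
  · nlinarith [hx.1, hx.2]
  · rcases lt_or_gt_of_ne (Finset.ne_of_mem_erase hi) with hij | hij
    · exact Or.inr ((ho.β_lt_α hij).le.trans hx.1)
    · exact Or.inl (hx.2.trans (ho.β_lt_α hij).le)

lemma Ordered.eval_nonneg_of_one_le_sq (ho : Ordered α β) {x : ℝ} (hx : 1 ≤ x ^ 2) :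
    0 ≤ (denPoly β).eval x * (numPoly α).eval x := by
  rw [eval_denPoly_mul_eval_numPoly]
  refine mul_nonneg (by linarith) (Finset.prod_nonneg fun i _ => ho.mul_nonneg_of_le_or_ge ?_)
  rcases le_abs'.1 (one_le_sq_iff_one_le_abs x |>.1 hx) with hx | hx
  · exact Or.inl (hx.trans (ho.neg_one_lt_α i).le)
  · exact Or.inr ((ho.β_lt_one i).le.trans hx)

namespace IsPellSolution

variable {x s t : ℝ} {j : Fin g}

lemma exists_eval (hp : IsPellSolution α β p S) :
    ∃ c : ℝ, 0 < c ∧ ∀ x : ℝ, c * (p.eval x ^ 2 - 1) =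
      (denPoly β).eval x * (numPoly α).eval x * S.eval x ^ 2 := by
  obtain ⟨c, hc, hpell⟩ := hp.pell
  exact ⟨c, hc, fun x => by simpa using congrArg (eval x) hpell⟩

lemma one_le_eval_sq (hp : IsPellSolution α β p S)
    (hx : 0 ≤ (denPoly β).eval x * (numPoly α).eval x) : 1 ≤ p.eval x ^ 2 := by
  obtain ⟨c, hc, hpell⟩ := hp.exists_eval
  have := nonneg_of_mul_nonneg_right (hpell x ▸ mul_nonneg hx (sq_nonneg _)) hc
  linarith

lemma eval_sq_eq_one (hp : IsPellSolution α β p S)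
    (hx : (denPoly β).eval x * (numPoly α).eval x * S.eval x = 0) : p.eval x ^ 2 = 1 := by
  obtain ⟨c, hc, hpell⟩ := hp.exists_eval
  refine sub_eq_zero.1 ((mul_eq_zero.1 ?_).resolve_left hc.ne')
  rw [hpell, pow_two, ← mul_assoc, hx, zero_mul]

lemma eval_sq_eq_one_of_eval_numPoly_mul (hp : IsPellSolution α β p S)
    (hx : (numPoly α * S).eval x = 0) : p.eval x ^ 2 = 1 :=
  hp.eval_sq_eq_one (by rw [mul_assoc, ← eval_mul, hx, mul_zero])

lemma eval_sq_eq_one_of_eval_denPoly (hp : IsPellSolution α β p S)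
    (hx : (denPoly β).eval x = 0) : p.eval x ^ 2 = 1 :=
  hp.eval_sq_eq_one (by rw [hx, zero_mul, zero_mul])

lemma eval_α_sq (hp : IsPellSolution α β p S) (j : Fin g) : p.eval (α j) ^ 2 = 1 :=
  hp.eval_sq_eq_one_of_eval_numPoly_mul (by
    rw [eval_mul, eval_numPoly, Finset.prod_eq_zero (Finset.mem_univ j) (sub_self _), zero_mul])

lemma eval_β_sq (hp : IsPellSolution α β p S) (j : Fin g) : p.eval (β j) ^ 2 = 1 :=
  hp.eval_sq_eq_one_of_eval_denPoly (by
    rw [eval_denPoly, Finset.prod_eq_zero (Finset.mem_univ j) (sub_self _), mul_zero])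

lemma natDegree (hp : IsPellSolution α β p S) : p.natDegree = g + S.natDegree + 1 := by
  obtain ⟨c, hc, hpell⟩ := hp.pell
  have hdeg := congrArg Polynomial.natDegree hpell
  rw [natDegree_C_mul hc.ne', ← C_1, natDegree_sub_C, natDegree_pow,
    natDegree_mul (monic_denPoly.mul monic_numPoly).ne_zero (pow_ne_zero 2 hp.factor_ne_zero),
    monic_denPoly.natDegree_mul monic_numPoly, natDegree_denPoly, natDegree_numPoly,
    natDegree_pow] at hdeg
  omega

lemma mem_of_eval_eq_zero (hp : IsPellSolution α β p S) (ho : Ordered α β)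
    (hx : p.eval x = 0) : x ∈ Ioo (-1) 1 ∧ ∀ j, x < α j ∨ β j < x := by
  have hneg : ¬ 0 ≤ (denPoly β).eval x * (numPoly α).eval x := fun hnonneg => by
    have := hp.one_le_eval_sq hnonneg
    rw [hx] at this
    norm_num at this
  refine ⟨abs_lt.1 ((sq_lt_one_iff_abs_lt_one _).1 (lt_of_not_ge fun hle =>
    hneg (ho.eval_nonneg_of_one_le_sq hle))), fun j => ?_⟩
  by_contra! hmem
  exact hneg (ho.eval_nonneg_of_mem_gap hmem)

lemma dvd_derivative (hp : IsPellSolution α β p S) : S ∣ derivative p := by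
  obtain ⟨c, hc, hpell⟩ := hp.pell
  have hcinv : C c⁻¹ * C c = (1 : ℝ[X]) := by rw [← C_mul, inv_mul_cancel₀ hc.ne', C_1]
  have hcop : IsCoprime S (C c * 2 * p) := by
    have hhalf : C (1 / 2) * 2 = (1 : ℝ[X]) := by
      rw [← C_ofNat, ← C_mul]
      norm_num
    refine ⟨-(C c⁻¹ * denPoly β * numPoly α * S), C c⁻¹ * C (1 / 2) * p, ?_⟩
    linear_combination C c⁻¹ * hpell + p ^ 2 * C c⁻¹ * C c * hhalf + hcinv
  have hderiv := congrArg derivative hpell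
  simp only [derivative_C, derivative_sub, derivative_pow, derivative_one, derivative_mul,
    Nat.cast_ofNat, Nat.add_one_sub_one, pow_one, C_ofNat] at hderiv
  refine hcop.dvd_of_dvd_mul_left ⟨derivative (denPoly β * numPoly α) * S +
    2 * (denPoly β * numPoly α) * derivative S, ?_⟩
  rw [derivative_mul]
  linear_combination hderiv

lemma eval_eq_of_mem_gap (hp : IsPellSolution α β p S) (ho : Ordered α β)
    (hs : s ∈ Icc (α j) (β j)) (ht : t ∈ Icc (α j) (β j))
    (hps : p.eval s ^ 2 = 1) (hpt : p.eval t ^ 2 = 1) : p.eval s = p.eval t := by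
  by_contra hne
  have hzero : (0 : ℝ) ∈ uIcc (p.eval s) (p.eval t) := by
    rw [mem_uIcc]
    rcases sq_eq_one_iff.1 hps with hs' | hs' <;> rcases sq_eq_one_iff.1 hpt with ht' | ht' <;>
      simp_all
  obtain ⟨w, hw, hw0⟩ := intermediate_value_uIcc p.continuous.continuousOn hzero
  have hgap : w ∈ Icc (α j) (β j) := ordConnected_Icc.uIcc_subset hs ht hw
  rcases (hp.mem_of_eval_eq_zero ho hw0).2 j with hlt | hlt
  · exact hlt.not_ge hgap.1
  · exact hlt.not_ge hgap.2

lemma exists_critical_point (hp : IsPellSolution α β p S) (ho : StrictlyOrdered α β) (j : Fin g) :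
    ∃ c ∈ Ioo (α j) (β j), p.derivative.eval c = 0 :=
  exists_derivative_eq_zero p (ho.2 j) (hp.eval_eq_of_mem_gap ho.ordered
    (left_mem_Icc.2 (ho.2 j).le) (right_mem_Icc.2 (ho.2 j).le) (hp.eval_α_sq j) (hp.eval_β_sq j))

lemma critical_point_unique (hp : IsPellSolution α β p S) (ho : Ordered α β)
    (hz : HasSimpleZerosIn p univ) (hs : s ∈ Icc (α j) (β j)) (ht : t ∈ Icc (α j) (β j))
    (hs0 : p.derivative.eval s = 0) (ht0 : p.derivative.eval t = 0) : s = t := by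
  wlog hlt : s < t generalizing s t
  · rcases (not_lt.1 hlt).eq_or_lt with heq | hgt
    · exact heq.symm
    · exact (this ht hs ht0 hs0 hgt).symm
  obtain ⟨x, hx, hsx, hxt⟩ := (hz.interlace_derivative (by rw [hp.natDegree]; omega)).2
    s hs0 t ht0 hlt
  rcases (hp.mem_of_eval_eq_zero ho hx).2 j with hxα | hxβ
  · exact absurd (hs.1.trans hsx.le) hxα.not_ge
  · exact absurd (hxt.le.trans ht.2) hxβ.not_ge

lemma eval_factor_ne_zero (hp : IsPellSolution α β p S) (ho : Ordered α β)
    (hz : HasSimpleZerosIn p univ) (hx : x ∈ Ioo (α j) (β j)) : S.eval x ≠ 0 := by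
  intro hSx
  have hpx : p.eval x ^ 2 = 1 := hp.eval_sq_eq_one (by rw [hSx, mul_zero])
  obtain ⟨c, hc, hc0⟩ := exists_derivative_eq_zero p hx.1 (hp.eval_eq_of_mem_gap ho
    (left_mem_Icc.2 (ho.2 j)) (Ioo_subset_Icc_self hx) (hp.eval_α_sq j) hpx)
  exact hc.2.ne (hp.critical_point_unique ho hz ⟨hc.1.le, (hc.2.trans hx.2).le⟩
    (Ioo_subset_Icc_self hx) hc0 (eval_eq_zero_of_dvd_of_eval_eq_zero hp.dvd_derivative hSx))

/-- There are only `g` critical points besides the zeros of `S`, hence one in each gap. -/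
lemma eval_factor_eq_zero_or_mem_gap (hp : IsPellSolution α β p S) (ho : StrictlyOrdered α β)
    (hz : HasSimpleZerosIn p univ) (ht : p.derivative.eval t = 0) :
    S.eval t = 0 ∨ ∃ j, t ∈ Ioo (α j) (β j) := by
  choose c hc hc0 using hp.exists_critical_point ho
  have hinj : Function.Injective c := StrictMono.injective fun i j hij =>
    (hc i).2.trans ((ho.ordered.β_lt_α hij).trans (hc j).1)
  obtain ⟨U, hU⟩ := hp.dvd_derivative
  have hU0 : U ≠ 0 := by
    rintro rfl
    rw [mul_zero, derivative_eq_zero, hp.natDegree] at hU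
    omega
  have hUdeg : U.natDegree ≤ g := by
    have hle := natDegree_derivative_le p
    rw [hU, natDegree_mul hp.factor_ne_zero hU0, hp.natDegree] at hle
    omega
  have hUc : HasSimpleZerosIn U (range c) := by
    refine .of_card hU0 (Z := Finset.univ.image c) ?_ ?_
    · simp only [Finset.mem_image, Finset.mem_univ, true_and, forall_exists_index,
        forall_apply_eq_imp_iff, mem_range_self]
      intro j
      have hj := hc0 j
      rw [hU, eval_mul] at hj
      exact (mul_eq_zero.1 hj).resolve_left (hp.eval_factor_ne_zero ho.ordered hz (hc j))
    · rwa [Finset.card_image_of_injective _ hinj, Finset.card_univ, Fintype.card_fin]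
  rw [hU, eval_mul] at ht
  refine (mul_eq_zero.1 ht).imp_right fun hUt => ?_
  obtain ⟨j, rfl⟩ := hUc.mem hUt
  exact ⟨j, hc j⟩

lemma exists_strictMono_mem_gap (hp : IsPellSolution α β p S) (ho : StrictlyOrdered α β)
    (hz : HasSimpleZerosIn p univ) {y : Fin k → ℝ} (hy : StrictMono y)
    (hyz : HasSimpleZerosIn p.derivative (range y)) (hy0 : ∀ i, p.derivative.eval (y i) = 0) :
    ∃ ι : Fin g → Fin k, StrictMono ι ∧ (∀ j, y (ι j) ∈ Ioo (α j) (β j)) ∧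
      ∀ i, S.eval (y i) = 0 ↔ i ∉ range ι := by
  have hex (j) : ∃ i, y i ∈ Ioo (α j) (β j) := by
    obtain ⟨c, hc, hc0⟩ := hp.exists_critical_point ho j
    obtain ⟨i, rfl⟩ := hyz.mem hc0
    exact ⟨i, hc⟩
  choose ι hι using hex
  refine ⟨ι, fun i j hij => hy.lt_iff_lt.1
    ((hι i).2.trans ((ho.ordered.β_lt_α hij).trans (hι j).1)),
    hι, fun i => ⟨?_, fun hi => ?_⟩⟩
  · rintro hSy ⟨j, rfl⟩
    exact hp.eval_factor_ne_zero ho.ordered hz (hι j) hSy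
  · refine (hp.eval_factor_eq_zero_or_mem_gap ho hz (hy0 i)).resolve_right ?_
    rintro ⟨j, hj⟩
    exact hi ⟨j, hy.injective (hp.critical_point_unique ho.ordered hz
      (Ioo_subset_Icc_self (hι j)) (Ioo_subset_Icc_self hj) (hy0 _) (hy0 i))⟩

end IsPellSolution

lemma forall_extend_iff {ι κ γ : Type*} {f : ι → κ} (hf : Function.Injective f) {a b : ι → γ}
    {c : κ → γ} {R : κ → γ → γ → Prop} :
    (∀ i, R i (Function.extend f a c i) (Function.extend f b c i)) ↔
      (∀ j, R (f j) (a j) (b j)) ∧ ∀ i ∉ range f, R i (c i) (c i) := by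
  refine ⟨fun hR => ⟨fun j => ?_, fun i hi => ?_⟩, fun hR i => ?_⟩
  · simpa only [hf.extend_apply] using hR (f j)
  · simpa only [Function.extend_apply' _ _ _ hi] using hR i
  · by_cases hi : i ∈ range f
    · obtain ⟨j, rfl⟩ := hi
      simpa only [hf.extend_apply] using hR.1 j
    · simpa only [Function.extend_apply' _ _ _ hi] using hR.2 i hi

/-- If every gap contains some separating point `y i` and the `x i` lie in the interior of `E`,
the remaining `y i` can be inserted as closed gaps. -/
lemma Ordered.insertsClosedGaps_extend (ho : Ordered α β) {x : Fin (k + 1) → ℝ} {y : Fin k → ℝ}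
    (hx : ∀ i, x i ∈ Ioo (-1) 1 ∧ ∀ j, x i < α j ∨ β j < x i)
    (hxy : ∀ i, x i.castSucc < y i ∧ y i < x i.succ) {ι : Fin g → Fin k} (hι : StrictMono ι)
    (hy : ∀ j, y (ι j) ∈ Icc (α j) (β j)) :
    InsertsClosedGaps α β (Function.extend ι α y) (Function.extend ι β y) := by
  set α' := Function.extend ι α y
  set β' := Function.extend ι β y
  have hsep : ∀ i, x i.castSucc < α' i ∧ α' i ≤ β' i ∧ β' i < x i.succ :=
    (forall_extend_iff hι.injective
      (R := fun i a b => x i.castSucc < a ∧ a ≤ b ∧ b < x i.succ)).2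
      ⟨fun j => ⟨((hx _).2 j).resolve_right ((hxy _).1.le.trans (hy j).2).not_gt, ho.2 j,
        ((hx _).2 j).resolve_left ((hy j).1.trans (hxy _).2.le).not_gt⟩,
      fun i _ => ⟨(hxy i).1, le_rfl, (hxy i).2⟩⟩
  have hord : Ordered α' β' := by
    refine ⟨fun i => (?_ : _ < x i).trans ?_, fun i => (hsep i).2.1⟩
    · cases i using Fin.cases with
      | zero => exact (hx 0).1.1
      | succ i => exact (hsep i).2.2
    · cases i using Fin.lastCases with
      | last => simpa using (hx (Fin.last k)).1.2
      | cast i => simpa using (hsep i).1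
  have hgaps (t : ℝ) : (∀ i, t ≤ α' i ∨ β' i ≤ t) ↔ ∀ j, t ≤ α j ∨ β j ≤ t :=
    (forall_extend_iff hι.injective (R := fun _ a b => t ≤ a ∨ b ≤ t)).trans
      (and_iff_left fun i _ => le_total t (y i))
  refine ⟨hord, ?_, ι, hι, fun j => ⟨hι.injective.extend_apply α y j,
    hι.injective.extend_apply β y j⟩, fun i hi => ?_⟩
  · simp only [hord.bandSet_eq, ho.bandSet_eq, hgaps]
  · exact (Function.extend_apply' α y i hi).trans (Function.extend_apply' β y i hi).symm

lemma aeval_numPoly_eq_zero {z : ℂ} : aeval z (numPoly α) = 0 ↔ ∃ j, z = α j := by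
  simp [numPoly, Finset.prod_eq_zero_iff, sub_eq_zero]

theorem IsPellSolution.exists_closedGaps (hp : IsPellSolution α β p S) (ho : StrictlyOrdered α β)
    (hz : HasSimpleZerosIn p univ) (hdeg : p.natDegree = k + 1) :
    ∃ α' β' : Fin k → ℝ, InsertsClosedGaps α β α' β' ∧
      (∀ t, p.derivative.eval t = 0 → ∃ i, t ∈ Icc (α' i) (β' i)) ∧
      ∀ z : ℂ, aeval z (numPoly α * S) = 0 ↔ ∃ i, z = α' i := by
  obtain ⟨x, y, hy, hxy, hx0, hyz, hy0⟩ := hz.exists_critical_points hdeg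
  obtain ⟨ι, hι, hyι, hfactor⟩ := hp.exists_strictMono_mem_gap ho hz hy hyz hy0
  refine ⟨Function.extend ι α y, Function.extend ι β y, ho.ordered.insertsClosedGaps_extend
    (fun i => hp.mem_of_eval_eq_zero ho.ordered ((hx0 _).2 (mem_range_self i))) hxy hι
    fun j => Ioo_subset_Icc_self (hyι j), fun t ht => ?_, fun z => ?_⟩
  · obtain ⟨i, rfl⟩ := hyz.mem ht
    exact ⟨i, (forall_extend_iff hι.injective (R := fun i a b => y i ∈ Icc a b)).2
      ⟨fun j => Ioo_subset_Icc_self (hyι j), fun _ _ => left_mem_Icc.2 le_rfl⟩ i⟩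
  rw [map_mul, mul_eq_zero, aeval_numPoly_eq_zero]
  constructor
  · rintro (⟨j, rfl⟩ | hSz)
    · exact ⟨ι j, by rw [hι.injective.extend_apply]⟩
    · obtain ⟨_, ⟨i, rfl⟩, -, rfl⟩ := hyz.exists_of_aeval
        (aeval_eq_zero_of_dvd_aeval_eq_zero hp.dvd_derivative hSz)
      have hi := (hfactor i).1 ((aeval_ofReal_eq_zero S _).1 hSz)
      exact ⟨i, by rw [Function.extend_apply' _ _ _ hi]⟩
  · rintro ⟨i, rfl⟩
    exact (forall_extend_iff hι.injective (b := β)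
      (R := fun _ a _ => (∃ j, (a : ℂ) = α j) ∨ aeval (a : ℂ) S = 0)).2
      ⟨fun j => .inl ⟨j, rfl⟩, fun i hi => .inr ((aeval_ofReal_eq_zero S _).2 ((hfactor i).2 hi))⟩ i

end Gaps

section Chebyshev

open Set

lemma hasSimpleZerosIn_T (n : ℕ) : HasSimpleZerosIn (Chebyshev.T ℝ n) (Ioo (-1) 1) where
  ne_zero := Chebyshev.T_ne_zero ℝ n
  splits := by
    rw [splits_iff_card_roots, Chebyshev.roots_T_real, Finset.card_val, Finset.card_image_of_injOn
      ((Finset.range n).nodup_map_iff_injOn.1 (Chebyshev.roots_T_real_nodup n))]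
    simp
  nodup_roots := by rw [Chebyshev.roots_T_real]; exact Finset.nodup _
  mem {x} hx := by
    refine abs_lt.1 (lt_of_not_ge fun hle => ?_)
    have := Chebyshev.one_le_abs_eval_T_real n hle
    rw [hx, abs_zero] at this
    exact this.not_gt one_pos

lemma natDegree_T_succ_ne_zero (n : ℕ) : (Chebyshev.T ℝ (n + 1 : ℕ)).natDegree ≠ 0 := by
  rw [Chebyshev.natDegree_T, Int.natAbs_natCast]
  exact n.succ_ne_zero

lemma U_eq_const_mul_derivative_T (n : ℕ) :
    Chebyshev.U ℝ n = C ((n : ℝ) + 1)⁻¹ * derivative (Chebyshev.T ℝ (n + 1 : ℕ)) := by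
  have hn : C ((n : ℝ) + 1)⁻¹ * ((n : ℝ[X]) + 1) = 1 := by
    rw [← C_eq_natCast, ← C_1, ← C_add, ← C_mul, inv_mul_cancel₀ n.cast_add_one_ne_zero]
  rw [Chebyshev.T_derivative_eq_U]
  push_cast
  rw [add_sub_cancel_right, ← mul_assoc, hn, one_mul]

lemma hasSimpleZerosIn_U (n : ℕ) : HasSimpleZerosIn (Chebyshev.U ℝ n) (Ioo (-1) 1) := by
  rw [U_eq_const_mul_derivative_T]
  exact ((hasSimpleZerosIn_T (n + 1)).derivative (natDegree_T_succ_ne_zero n)).const_mul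
    (inv_ne_zero n.cast_add_one_ne_zero)

lemma interlace_zeros_T_U (n : ℕ) :
    Interlace {x | (Chebyshev.T ℝ (n + 1 : ℕ)).eval x = 0} {x | (Chebyshev.U ℝ n).eval x = 0} := by
  rw [U_eq_const_mul_derivative_T]
  simpa only [eval_mul, eval_C, mul_eq_zero,
    or_iff_right (inv_ne_zero (n.cast_add_one_ne_zero (R := ℝ)))] using
    (hasSimpleZerosIn_T (n + 1)).interlace_derivative (natDegree_T_succ_ne_zero n)

end Chebyshev

section Pullback

open Set

lemma Interlace.preimage {A B s : Set ℝ} (hAB : Interlace A B) {f : ℝ → ℝ}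
    (hf : StrictMonoOn f s ∨ StrictAntiOn f s) (hA : A ⊆ f '' s) (hB : B ⊆ f '' s) :
    Interlace {x ∈ s | f x ∈ A} {x ∈ s | f x ∈ B} := by
  have exists_between {C D : Set ℝ} (hCD : ∀ x ∈ C, ∀ x' ∈ C, x < x' → ∃ y ∈ D, x < y ∧ y < x')
      (hD : D ⊆ f '' s) : ∀ x ∈ {x ∈ s | f x ∈ C}, ∀ x' ∈ {x ∈ s | f x ∈ C}, x < x' →
        ∃ y ∈ {x ∈ s | f x ∈ D}, x < y ∧ y < x' := by
    rintro x ⟨hx, hxC⟩ x' ⟨hx', hxC'⟩ hlt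
    rcases hf with hf | hf
    · obtain ⟨_, hyD, hxy, hyx⟩ := hCD _ hxC _ hxC' (hf hx hx' hlt)
      obtain ⟨y, hy, rfl⟩ := hD hyD
      exact ⟨y, ⟨hy, hyD⟩, (hf.lt_iff_lt hx hy).1 hxy, (hf.lt_iff_lt hy hx').1 hyx⟩
    · obtain ⟨_, hyD, hxy, hyx⟩ := hCD _ hxC' _ hxC (hf hx hx' hlt)
      obtain ⟨y, hy, rfl⟩ := hD hyD
      exact ⟨y, ⟨hy, hyD⟩, (hf.lt_iff_gt hy hx).1 hyx, (hf.lt_iff_gt hx' hy).1 hxy⟩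
  exact ⟨exists_between hAB.1 hB, exists_between hAB.2 hA⟩

lemma bijOn_Icc_of_injOn {f : ℝ → ℝ} {l r : ℝ} (hlr : l < r) (hc : ContinuousOn f (Icc l r))
    (hi : InjOn f (Icc l r)) (hl : f l ^ 2 = 1) (hr : f r ^ 2 = 1) :
    BijOn f (Icc l r) (Icc (-1) 1) := by
  have hml : l ∈ Icc l r := left_mem_Icc.2 hlr.le
  have hmr : r ∈ Icc l r := right_mem_Icc.2 hlr.le
  rcases hc.strictMonoOn_of_injOn_Icc' hlr.le hi with hm | hm
  · obtain ⟨h1, h2⟩ : f l = -1 ∧ f r = 1 := by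
      have := hm hml hmr hlr
      rcases sq_eq_one_iff.1 hl with hl | hl <;> rcases sq_eq_one_iff.1 hr with hr | hr <;>
        constructor <;> linarith
    exact ⟨by simpa only [h1, h2] using hm.monotoneOn.mapsTo_Icc, hi, fun c hcc =>
      intermediate_value_Icc hlr.le hc (by rwa [h1, h2])⟩
  · obtain ⟨h1, h2⟩ : f l = 1 ∧ f r = -1 := by
      have := hm hml hmr hlr
      rcases sq_eq_one_iff.1 hl with hl | hl <;> rcases sq_eq_one_iff.1 hr with hr | hr <;>
        constructor <;> linarith
    exact ⟨by simpa only [h1, h2] using hm.antitoneOn.mapsTo_Icc, hi, fun c hcc =>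
      intermediate_value_Icc' hlr.le hc (by rwa [h1, h2])⟩

variable {k : ℕ} {α β : Fin k → ℝ} {p f : ℝ[X]}

/-- A polynomial of degree `k + 1` that maps each of the `k + 1` bands bijectively onto
`[-1, 1]`, given by its end point values and injectivity. -/
structure MapsBands (α β : Fin k → ℝ) (p : ℝ[X]) : Prop where
  ordered : Ordered α β
  natDegree : p.natDegree = k + 1
  injOn (i : Fin (k + 1)) : InjOn (fun x => p.eval x) (band α β i)
  left (i : Fin (k + 1)) : p.eval (bandLeft β i) ^ 2 = 1
  right (i : Fin (k + 1)) : p.eval (bandRight α i) ^ 2 = 1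

lemma interior_band (i : Fin (k + 1)) :
    interior (band α β i) = Ioo (bandLeft β i) (bandRight α i) :=
  interior_Icc

lemma Ordered.ne_of_mem_interior (ho : Ordered α β) {i : Fin (k + 1)} {x : ℝ}
    (hx : x ∈ interior (band α β i)) (j : Fin k) : x ≠ α j := by
  rw [interior_band] at hx
  rcases ho.lt_or_gt_of_mem_Ioo hx j with hlt | hlt
  · exact hlt.ne
  · exact ((ho.2 j).trans_lt hlt).ne'

lemma Ordered.eq_of_mem_interior (ho : Ordered α β) {i j : Fin (k + 1)} {x : ℝ}
    (hi : x ∈ interior (band α β i)) (hj : x ∈ interior (band α β j)) : i = j := by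
  wlog hij : i < j generalizing i j
  · rcases (not_lt.1 hij).eq_or_lt with heq | hgt
    · exact heq.symm
    · exact (this hj hi hgt).symm
  rw [interior_band] at hi hj
  exact absurd (hi.2.trans_le (ho.right_le_left hij)) hj.1.not_gt

namespace MapsBands

lemma bijOn (hp : MapsBands α β p) (i : Fin (k + 1)) :
    BijOn (fun x => p.eval x) (band α β i) (Icc (-1) 1) :=
  bijOn_Icc_of_injOn (hp.ordered.1 i) p.continuous.continuousOn (hp.injOn i) (hp.left i)
    (hp.right i)

lemma mem_interior (hp : MapsBands α β p) {i : Fin (k + 1)} {x : ℝ} (hx : x ∈ band α β i)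
    (hpx : p.eval x ∈ Ioo (-1) 1) : x ∈ interior (band α β i) := by
  have hne : p.eval x ^ 2 ≠ 1 := ((sq_lt_one_iff_abs_lt_one _).2 (abs_lt.2 hpx)).ne
  rw [interior_band]
  refine ⟨hx.1.lt_of_ne ?_, hx.2.lt_of_ne ?_⟩
  · rintro rfl
    exact hne (hp.left i)
  · rintro rfl
    exact hne (hp.right i)

lemma zeros_comp_subset_interior (hp : MapsBands α β p) (hf : HasSimpleZerosIn f (Ioo (-1) 1))
    (i : Fin (k + 1)) :
    {x ∈ band α β i | (f.comp p).eval x = 0} ⊆ interior (band α β i) := fun _ hx =>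
  hp.mem_interior hx.1 (hf.mem (eval_comp (p := f) ▸ hx.2))

lemma encard_zeros_comp (hp : MapsBands α β p) (hf : HasSimpleZerosIn f (Ioo (-1) 1))
    (i : Fin (k + 1)) : {x ∈ band α β i | (f.comp p).eval x = 0}.encard = f.natDegree := by
  have himage : (fun x => p.eval x) '' {x ∈ band α β i | (f.comp p).eval x = 0} =
      f.roots.toFinset := by
    ext c
    simp only [eval_comp, Finset.mem_coe, Multiset.mem_toFinset, mem_roots hf.ne_zero, IsRoot]
    constructor
    · rintro ⟨x, hx, rfl⟩
      exact hx.2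
    · intro hc
      obtain ⟨x, hx, rfl⟩ := (hp.bijOn i).surjOn (Ioo_subset_Icc_self (hf.mem hc))
      exact ⟨x, ⟨hx, hc⟩, rfl⟩
  rw [← ((hp.injOn i).mono fun _ hx => hx.1).encard_image, himage, encard_coe_eq_coe_finsetCard,
    hf.card_roots_toFinset]

lemma hasSimpleZerosIn_comp (hp : MapsBands α β p) (hf : HasSimpleZerosIn f (Ioo (-1) 1)) :
    HasSimpleZerosIn (f.comp p) (⋃ i, interior (band α β i)) := by
  have hex (i : Fin (k + 1)) : ∀ c ∈ Ioo (-1 : ℝ) 1, ∃ x ∈ interior (band α β i), p.eval x = c := by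
    intro c hc
    obtain ⟨x, hx, rfl⟩ := (hp.bijOn i).surjOn (Ioo_subset_Icc_self hc)
    exact ⟨x, hp.mem_interior hx hc, rfl⟩
  choose! x hx hpx using hex
  have hroot {c : ℝ} (hc : c ∈ f.roots.toFinset) : f.eval c = 0 := by simp_all
  refine .of_card (Z := (Finset.univ ×ˢ f.roots.toFinset).image fun ic => x ic.1 ic.2) ?_ ?_ ?_
  · have hdeg := hp.natDegree
    rw [Ne, comp_eq_zero_iff, not_or, not_and]
    refine ⟨hf.ne_zero, fun _ hconst => ?_⟩
    rw [hconst, natDegree_C] at hdeg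
    omega
  · simp only [Finset.mem_image, Finset.mem_product, Finset.mem_univ, true_and]
    rintro _ ⟨⟨i, c⟩, hc, rfl⟩
    have hc1 := hf.mem (hroot hc)
    exact ⟨mem_iUnion_of_mem i (hx i c hc1), by rw [eval_comp, hpx i c hc1, hroot hc]⟩
  · rw [Finset.card_image_of_injOn, Finset.card_product, Finset.card_univ, Fintype.card_fin,
      natDegree_comp, hp.natDegree, hf.card_roots_toFinset, mul_comm]
    rintro ⟨i, c⟩ hc ⟨j, d⟩ hd (heq : x i c = x j d)
    have hc1 := hf.mem (hroot (Finset.mem_product.1 hc).2)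
    have hd1 := hf.mem (hroot (Finset.mem_product.1 hd).2)
    rw [Prod.mk.injEq, ← hpx i c hc1, ← hpx j d hd1, heq]
    exact ⟨hp.ordered.eq_of_mem_interior (hx i c hc1) (heq ▸ hx j d hd1), rfl⟩

lemma interlace_zeros_comp (hp : MapsBands α β p) {q : ℝ[X]}
    (hf : HasSimpleZerosIn f (Ioo (-1) 1)) (hq : HasSimpleZerosIn q (Ioo (-1) 1))
    (hfq : Interlace {x | f.eval x = 0} {x | q.eval x = 0}) (i : Fin (k + 1)) :
    Interlace {x ∈ band α β i | (f.comp p).eval x = 0}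
      {x ∈ band α β i | (q.comp p).eval x = 0} := by
  simp only [eval_comp]
  refine hfq.preimage (p.continuous.continuousOn.strictMonoOn_of_injOn_Icc' (hp.ordered.1 i).le
    (hp.injOn i)) ?_ ?_
  · exact fun c hc => (hp.bijOn i).surjOn (Ioo_subset_Icc_self (hf.mem hc))
  · exact fun c hc => (hp.bijOn i).surjOn (Ioo_subset_Icc_self (hq.mem hc))

end MapsBands

section

variable {g : ℕ} {α β : Fin g → ℝ} {α' β' : Fin k → ℝ} {p S : ℝ[X]}

theorem IsPellSolution.mapsBands (hp : IsPellSolution α β p S) (hdeg : p.natDegree = k + 1)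
    (hins : InsertsClosedGaps α β α' β')
    (hcrit : ∀ t, p.derivative.eval t = 0 → ∃ i, t ∈ Icc (α' i) (β' i))
    (hzeros : ∀ i, (numPoly α * S).eval (α' i) = 0) : MapsBands α' β' p := by
  obtain ⟨ho, -, ι, -, hι, hclosed⟩ := hins
  have hα' (i) : p.eval (α' i) ^ 2 = 1 := hp.eval_sq_eq_one_of_eval_numPoly_mul (hzeros i)
  refine ⟨ho, hdeg, fun i s hs t ht heq => ?_, fun i => ?_, fun i => ?_⟩
  · wlog hlt : s < t generalizing s t
    · rcases (not_lt.1 hlt).eq_or_lt with hst | hgt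
      · exact hst.symm
      · exact (this t ht s hs heq.symm hgt).symm
    obtain ⟨c, hc, hc0⟩ := exists_derivative_eq_zero p hlt heq
    obtain ⟨j, hj⟩ := hcrit c hc0
    rcases ho.lt_or_gt_of_mem_Ioo ⟨hs.1.trans_lt hc.1, hc.2.trans_le ht.2⟩ j with hcj | hcj
    · exact absurd hj.1 hcj.not_ge
    · exact absurd hj.2 hcj.not_ge
  · cases i using Fin.cases with
    | zero => exact hp.eval_sq_eq_one_of_eval_denPoly (by simp)
    | succ i =>
      rw [bandLeft_succ]
      by_cases hi : i ∈ range ι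
      · obtain ⟨j, rfl⟩ := hi
        rw [(hι j).2, hp.eval_β_sq]
      · rw [← hclosed i hi, hα']
  · cases i using Fin.lastCases with
    | last => exact hp.eval_sq_eq_one_of_eval_denPoly (by simp)
    | cast i => rw [bandRight_castSucc, hα']

end

end Pullback

section ZerosAtMultiples

open Set

variable {g K k : ℕ} {α β : Fin g → ℝ} {α' β' : Fin k → ℝ} {S : ℝ[X]}

theorem HasPeriod.exists_mapsBands (hper : HasPeriod α β (k + 1)) (ho : StrictlyOrdered α β) :
    ∃ (S : ℝ[X]) (α' β' : Fin k → ℝ), IsPellFactor α β (k + 1) S ∧ InsertsClosedGaps α β α' β' ∧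
      MapsBands α' β' (normPoly α β (k + 1)) ∧
        ∀ z : ℂ, aeval z (numPoly α * S) = 0 ↔ ∃ j, z = α' j := by
  obtain ⟨S, hS⟩ := hper.exists_isPellFactor ho k.succ_pos
  have hp := hS.isPellSolution ho.ordered
  have hdeg := natDegree_normPoly ho.ordered (k + 1)
  obtain ⟨α', β', hins, hcrit, hzeros⟩ :=
    hp.exists_closedGaps ho (hasSimpleZerosIn_normPoly ho.ordered (k + 1)) hdeg
  have hm := hp.mapsBands hdeg hins hcrit fun j =>
    (aeval_ofReal_eq_zero _ _).1 ((hzeros _).2 ⟨j, rfl⟩)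
  exact ⟨S, α', β', hS, hins, hm, hzeros⟩

lemma IsPellFactor.exists_P_mul_eq (hS : IsPellFactor α β K S) (ho : Ordered α β) (n : ℕ) :
    ∃ c ≠ 0, P α β (n * K) = C c * (Chebyshev.T ℝ n).comp (normPoly α β K) :=
  have := Δ_pos ho K
  ⟨Δ α β K ^ n * ((2 : ℝ) ^ (n - 1))⁻¹, by positivity,
    by rw [hS.P_mul ho, monicT, mul_comp, C_comp, C_mul, mul_assoc]⟩

lemma IsPellFactor.eval_P_mul_eq_zero (hS : IsPellFactor α β K S) (ho : Ordered α β) (n : ℕ)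
    (x : ℝ) : (P α β (n * K)).eval x = 0 ↔
      ((Chebyshev.T ℝ n).comp (normPoly α β K)).eval x = 0 := by
  obtain ⟨c, hc, heq⟩ := hS.exists_P_mul_eq ho n
  rw [heq, eval_mul, eval_C, mul_eq_zero, or_iff_right hc]

lemma IsPellFactor.hasSimpleZerosIn_P_mul (hS : IsPellFactor α β K S) (ho : Ordered α β)
    (hm : MapsBands α' β' (normPoly α β K)) (n : ℕ) :
    HasSimpleZerosIn (P α β (n * K)) (⋃ i, interior (band α' β' i)) := by
  obtain ⟨c, hc, heq⟩ := hS.exists_P_mul_eq ho n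
  rw [heq]
  exact (hm.hasSimpleZerosIn_comp (hasSimpleZerosIn_T n)).const_mul hc

lemma IsPellFactor.Q_mul_eq_zero (hS : IsPellFactor α β K S) (ho : Ordered α β) (n : ℕ) (z : ℂ) :
    Q α β ((n + 1) * K) z = 0 ↔ aeval z (numPoly α * S) = 0 ∨
      aeval z ((Chebyshev.U ℝ n).comp (normPoly α β K)) = 0 := by
  have heq := congrArg (aeval z) (hS.two_pow_mul ho n).2
  have hΔ : algebraMap ℝ ℂ (Δ α β K ^ n) ≠ 0 :=
    (_root_.map_ne_zero _).2 (pow_ne_zero n (Δ_pos ho K).ne')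
  rw [map_mul, map_mul, map_mul, aeval_C, map_pow, map_ofNat, ← Q_eq_aeval ho] at heq
  rw [← mul_eq_zero_iff_left (pow_ne_zero n (two_ne_zero' ℂ)), heq, mul_assoc,
    mul_eq_zero_iff_left hΔ, mul_eq_zero, hS.secondPoly_eq]

lemma IsPellFactor.zeros_Q_interior (hS : IsPellFactor α β K S) (ho : Ordered α β)
    (hm : MapsBands α' β' (normPoly α β K))
    (hzeros : ∀ z : ℂ, aeval z (numPoly α * S) = 0 ↔ ∃ j, z = α' j) (n : ℕ) (i : Fin (k + 1)) :
    {x ∈ interior (band α' β' i) | Q α β ((n + 1) * K) (x : ℂ) = 0} =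
      {x ∈ band α' β' i | ((Chebyshev.U ℝ n).comp (normPoly α β K)).eval x = 0} := by
  ext x
  simp only [mem_ofPred_eq, hS.Q_mul_eq_zero ho, hzeros, Complex.ofReal_inj, aeval_ofReal_eq_zero]
  constructor
  · rintro ⟨hx, ⟨j, hj⟩ | hU⟩
    · exact absurd hj (hm.ordered.ne_of_mem_interior hx j)
    · exact ⟨interior_subset hx, hU⟩
  · exact fun hx => ⟨hm.zeros_comp_subset_interior (hasSimpleZerosIn_U n) i hx, .inr hx.2⟩

end ZerosAtMultiples

end GenCheb

end

theorem theorem4p2 {g : ℕ} (α β : Fin g → ℝ) (hαβ : StrictlyOrdered α β)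
    (K : ℕ) (hK : 1 ≤ K) (hper : HasPeriod α β K) :
    -- the `K` subintervals that make up `E`, each mapped bijectively onto `[-1, 1]`
    ∃ α' β' : Fin (K - 1) → ℝ, InsertsClosedGaps α β α' β' ∧
      (∀ i, Set.BijOn (fun x => (P α β K).eval x / Δ α β K) (band α' β' i) (Set.Icc (-1) 1)) ∧
      -- the polynomials of the first kind
      (∀ n : ℕ,
        P α β (n * K) =
          C (Δ α β K ^ n) * (monicT n).comp (C (Δ α β K)⁻¹ * P α β K) ∧
        (∀ z : ℂ, aeval z (P α β (n * K)) = 0 → ∃ x ∈ bandSet α β, z = (x : ℂ)) ∧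
        (P α β (n * K)).roots.Nodup ∧
        ∀ i,
          {x ∈ band α' β' i | (P α β (n * K)).eval x = 0}.encard = n ∧
          {x ∈ band α' β' i | (P α β (n * K)).eval x = 0} ⊆ interior (band α' β' i)) ∧
      -- the polynomials of the second kind
      (∀ n : ℕ, 1 ≤ n →
        (∀ j, Q α β (n * K) (α' j : ℂ) = 0) ∧
        (∀ z : ℂ, Q α β (n * K) z = 0 →
          (∃ j, z = (α' j : ℂ)) ∨ ∃ i, ∃ x ∈ interior (band α' β' i), z = (x : ℂ)) ∧
        ∀ i,
          {x ∈ interior (band α' β' i) | Q α β (n * K) (x : ℂ) = 0}.encard = ((n - 1 : ℕ) : ℕ∞) ∧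
          Interlace {x ∈ band α' β' i | (P α β (n * K)).eval x = 0}
            {x ∈ interior (band α' β' i) | Q α β (n * K) (x : ℂ) = 0}) := by
  obtain ⟨k, rfl⟩ : ∃ k, K = k + 1 := Nat.exists_eq_add_one.2 hK
  have ho := hαβ.ordered
  obtain ⟨S, α', β', hS, hins, hm, hzeros⟩ := hper.exists_mapsBands hαβ
  refine ⟨α', β', hins, fun i => by simpa only [eval_normPoly] using hm.bijOn i,
    fun n => ⟨hS.P_mul ho n, ?_, (hS.hasSimpleZerosIn_P_mul ho hm n).nodup_roots, fun i => ?_⟩,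
    fun n hn => ?_⟩
  · intro z hz
    obtain ⟨x, hx, -, rfl⟩ := (hS.hasSimpleZerosIn_P_mul ho hm n).exists_of_aeval hz
    exact ⟨x, hins.2.1 ▸ Set.iUnion_mono (fun i => interior_subset) hx, rfl⟩
  · simp only [hS.eval_P_mul_eq_zero ho, hm.encard_zeros_comp (hasSimpleZerosIn_T n)]
    exact ⟨by simp, hm.zeros_comp_subset_interior (hasSimpleZerosIn_T n) i⟩
  · obtain ⟨n, rfl⟩ : ∃ m, n = m + 1 := Nat.exists_eq_add_one.2 hn
    refine ⟨fun j => (hS.Q_mul_eq_zero ho n _).2 (.inl ((hzeros _).2 ⟨j, rfl⟩)),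
      fun z hz => ((hS.Q_mul_eq_zero ho n z).1 hz).imp (hzeros z).1 fun hU => ?_, fun i => ?_⟩
    · obtain ⟨x, hx, -, rfl⟩ := (hm.hasSimpleZerosIn_comp (hasSimpleZerosIn_U n)).exists_of_aeval hU
      obtain ⟨i, hi⟩ := Set.mem_iUnion.1 hx
      exact ⟨i, x, hi, rfl⟩
    · simp only [hS.zeros_Q_interior ho hm hzeros, hS.eval_P_mul_eq_zero ho,
        hm.encard_zeros_comp (hasSimpleZerosIn_U n), Chebyshev.natDegree_U_natCast]
      exact ⟨rfl, hm.interlace_zeros_comp (hasSimpleZerosIn_T _) (hasSimpleZerosIn_U n)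
        (interlace_zeros_T_U n) i⟩
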